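/- **Setting.** Let $u<v$ be real numbers with $v\neq0$, $r=v-u$, and let $\gamma$ be the round unit metric on $\mathbb S^2$. All norms, inner products $\cdot$, $\mathring{\mathrm{div}}$, $\mathring\triangle$, Hodge duals and harmonics below refer to $\gamma$. $\|T\|_{H^m}$ is the square root of $\sum_{i=0}^m\|\mathring\nabla^iT\|^2_{L^2(\mathbb S^2)}$ (weak derivatives); for $m\ge2$ elements of $H^m$ are identified with their $C^{m-2}$ representatives. **Sphere data.** $C^3$-sphere data on $S_{u,v}\cong\mathbb S^2$ is a tuple $$\mathfrak X=(\Omega,g,\Omega\mathrm{tr}\chi,\hat\chi,\Omega\mathrm{tr}\underline\chi,\hat{\underline\chi},\eta,\omega,D\omega,\underline\omega,\underline D\underline\omega,\alpha,\underline\alpha;\ D^2\omega,\underline D^2\underline\omega,\hat D\alpha,\hat{\underline D}\underline\alpha),$$ where $\Omega>0$ is a function, $g$ a Riemannian metric, $\eta$ a one-form, $\hat\chi,\hat{\underline\chi},\alpha,\underline\alpha,\hat D\alpha,\hat{\underline D}\underline\alpha$ are symmetric $2$-tensors that are trace-free with respect to $g$, and the other components are functions (the entries are independent of each other; $D\omega$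 etc. are names). Its norm $\|\mathfrak X\|_{\mathcal X}$, assumed finite, is the sum of the norms of the components, in $H^8$ for $\Omega,g,\Omega\mathrm{tr}\chi,\hat\chi,\omega,D\omega,\alpha,D^2\omega,\hat D\alpha$; $H^7$ for $\eta$; $H^6$ for $\Omega\mathrm{tr}\underline\chi,\hat{\underline\chi},\underline\omega$; $H^4$ for $\underline D\underline\omega,\underline\alpha$; $H^2$ for $\underline D^2\underline\omega,\hat{\underline D}\underline\alpha$. The reference Minkowski data is $\mathfrak m=(1,v^2\gamma,\tfrac2v,0,-\tfrac2v,0,\dots,0)$. Write $g=\phi^2g_c$ with $\phi>0$ and $\det g_c=\det\gamma$. **Harmonics.** $Y^{lm}$ are the standard real orthonormal spherical harmonics; for $l\ge1$, $E^{lm}=-\frac{1}{\sqrt{l(l+1)}}dY^{lm}$ and $H^{lm}=\frac1{\sqrt{l(l+1)}}{}^*dY^{lm}$; for $l\ge2$, $\psi^{lm}$ and $\phi^{lm}$ are $(\frac12l(l+1)-1)^{-1/2}\mathcal D_2^*$ applied to $E^{lm}$ and $H^{lm}$, where $(\mathcal D_2^*V)_{AB}=-\frac12(\mathring\nabla_AV_B+\mathring\nabla_BV_A-\mathring{\mathrm{div}}V\,\gamma_{AB})$.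 The coefficients of functions, one-forms and $2$-tensors are $f^{(lm)}=\int fY^{lm}d\mu_\gamma$, $V_E^{(lm)}=\int V\cdot E^{lm}d\mu_\gamma$, and likewise $V_H^{(lm)}$, $W_\psi^{(lm)}$, $W_\phi^{(lm)}$. A superscript $[l]$, $[\le l]$, $[\ge l]$ denotes the part of a function, a one-form, or (the $\gamma$-trace-free part of) a symmetric $2$-tensor made of the harmonics of these degrees. **Matching data.** $\mathfrak M(\mathfrak X)$ is the tuple consisting of $$\Omega,\ \phi,\ g_c,\ \Omega\mathrm{tr}\chi,\ \hat\chi,\ (\Omega\mathrm{tr}\underline\chi)^{[\ge2]},\ \hat{\underline\chi},\ \eta^{[\ge2]},\ \omega,\ D\omega,\ \underline\omega^{[\ge2]},\ (\underline D\underline\omega)^{[\ge2]},\ \mathcal Q_0,\ \mathcal Q_1,\ \alpha,\ \underline\alpha,\ D^2\omega,\ (\underline D^2\underline\omega)^{[\ge2]},\ \mathcal Q_2,\ \hat D\alpha,\ (\hat{\underline D}\underline\alpha)^{[\ge3]},$$ where, with $A=(\Omega\mathrm{tr}\chi-\frac4v\Omega)^{[\le1]}$, $$\begin{aligned}\mathcal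 Q_0&=\underline\omega^{[\le1]}+\tfrac14(\Omega\mathrm{tr}\underline\chi)^{[\le1]}-\tfrac1{6r}\mathring{\mathrm{div}}\,\eta^{[1]}-\tfrac1{12v^3}(\mathring\triangle+3)A-\tfrac1{2v^2}(\mathring\triangle+2)\phi^{[\le1]},\\ \mathcal Q_1&=(\underline D\underline\omega)^{[\le1]}-\tfrac16(\mathring\triangle-3)\big(\tfrac1v\Omega\mathrm{tr}\underline\chi-\tfrac2{v^3}(\mathring\triangle+2)\phi\big)^{[\le1]}+\tfrac1{6r}(\mathring\triangle\mathring\triangle+\mathring\triangle-3)A-\tfrac2{3v^2}\mathring{\mathrm{div}}\,\eta^{[1]},\\ \mathcal Q_2&=(\underline D^2\underline\omega)^{[\le1]}-\tfrac12(\mathring\triangle-3)\big(\tfrac1{v^2}\Omega\mathrm{tr}\underline\chi-\tfrac2{v^4}(\mathring\triangle+2)\phi\big)^{[\le1]}+\tfrac1{2v^2}(\mathring\triangle\mathring\triangle+2\mathring\triangle-3)A-\tfrac1{v^3}\mathring{\mathrm{div}}\,\eta^{[1]}.\end{aligned}$$ **Charges.** Let $\nabla,\mathrm{div},K,(\cdot,\cdot)$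 be the Levi-Civita connection, divergence, Gauss curvature and inner product of $g$, let $\mathrm{tr}\chi=\Omega^{-1}(\Omega\mathrm{tr}\chi)$, $\mathrm{tr}\underline\chi=\Omega^{-1}(\Omega\mathrm{tr}\underline\chi)$, $\zeta=\eta-d\log\Omega$, and let $\rho,\beta$ be given by the Gauss and Codazzi equations $$-\rho=K+\tfrac14\mathrm{tr}\chi\,\mathrm{tr}\underline\chi-\tfrac12(\hat\chi,\hat{\underline\chi}),\qquad-\beta=\mathrm{div}\hat\chi-\tfrac12d\,\mathrm{tr}\chi+\hat\chi\cdot\zeta-\tfrac12\mathrm{tr}\chi\,\zeta,$$ where $\hat\chi\cdot\zeta$ is the contraction by $g$. With $(\nabla\hat\otimes Y)_{AB}=\nabla_AY_B+\nabla_BY_A-(\mathrm{div}Y)g_{AB}$, the charges are $$\begin{aligned}\mathbf E&=-\tfrac{1}{8\pi}\sqrt{4\pi}\,\big(\phi^3(\rho+\phi\,\mathrm{div}\beta)\big)^{(00)},&\mathbf P^m&=-\tfrac1{8\pi}\sqrt{\tfrac{4\pi}3}\,\big(\phi^3(\rho+\phi\,\mathrm{div}\beta)\big)^{(1m)},\\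 \mathbf L^m&=\tfrac1{16\pi}\sqrt{\tfrac{8\pi}3}\,\big(\phi^3(d\,\mathrm{tr}\chi+\mathrm{tr}\chi\,\zeta)\big)_H^{(1m)},&\mathbf G^m&=\tfrac1{16\pi}\sqrt{\tfrac{8\pi}3}\,\big(\phi^3(d\,\mathrm{tr}\chi+\mathrm{tr}\chi\,\zeta)\big)_E^{(1m)}\end{aligned}$$ for $m=-1,0,1$, and, for $m=-2,\dots,2$, $$\mathbf U^m=\mathcal W_\psi^{(2m)},\qquad\mathbf V^m=\mathcal W_\phi^{(2m)},\qquad\mathcal W=\tfrac1\phi\hat{\underline D}\underline\alpha+\tfrac1{\phi^2}(1+\phi^2\nabla\hat\otimes\mathrm{div})\underline\alpha .$$ **Statement.** There is $\varepsilon>0$ (depending only on $u,v$) such that the following holds for all $C^3$-sphere data $\mathfrak X,\mathfrak X'$ on $S_{u,v}$: if $$\|\mathfrak X-\mathfrak m\|_{\mathcal X}+\|\mathfrak X'-\mathfrak m\|_{\mathcal X}<\varepsilon,\qquad \mathfrak M(\mathfrak X)=\mathfrak M(\mathfrak X'),\qquad(\mathbf E,\mathbf P,\mathbf L,\mathbf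 G,\mathbf U,\mathbf V)(\mathfrak X)=(\mathbf E,\mathbf P,\mathbf L,\mathbf G,\mathbf U,\mathbf V)(\mathfrak X'),$$ then $\mathfrak X=\mathfrak X'$. -/

import Mathlib

open scoped ENNReal ContDiff

noncomputable section

namespace NullGluing

/-! ### The unit sphere and tangential tensor fields

Covariant tensors on the unit sphere of three-dimensional Euclidean space are written in ambient
Cartesian components: a tangential tensor is one that vanishes as soon as the normal vector (the
position vector) is inserted into one of its slots. The inner product of the round unit metric is
then the Euclidean product of the components, which is also used to raise and lower indices. -/

/-- Euclidean three-space. -/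
abbrev E3 : Type := EuclideanSpace ℝ (Fin 3)

/-- The unit two-sphere. -/
abbrev S2 : Type := Metric.sphere (0 : E3) 1

/-- The area measure of the round unit sphere (total mass `4 * π`). -/
def area : MeasureTheory.Measure S2 := (MeasureTheory.volume : MeasureTheory.Measure E3).toSphere

lemma pole_mem : (EuclideanSpace.single 2 1 : E3) ∈ Metric.sphere (0 : E3) 1 := by
  simp

lemma normalize_mem {y : E3} (h : y ≠ 0) : ‖y‖⁻¹ • y ∈ Metric.sphere (0 : E3) 1 := by
  have : ‖y‖ ≠ 0 := norm_ne_zero_iff.mpr h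
  simp [norm_smul, this]

open Classical in
/-- The radial projection `y ↦ y / |y|` onto the sphere (with a dummy value at the origin). -/
def radial (y : E3) : S2 :=
  if h : y = 0 then ⟨EuclideanSpace.single 2 1, pole_mem⟩ else ⟨‖y‖⁻¹ • y, normalize_mem h⟩

/-- Fields of rank `k` covariant tensors in ambient components. -/
abbrev TField (k : ℕ) : Type := S2 → (Fin k → Fin 3) → ℝ

/-- Scalar functions, one-forms and two-tensors, in ambient components. -/
abbrev Scalar : Type := S2 → ℝ
abbrev Form : Type := S2 → Fin 3 → ℝ
abbrev Tensor2 : Type := S2 → Matrix (Fin 3) (Fin 3) ℝ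

def ofScalar (f : Scalar) : TField 0 := fun x _ => f x
def ofForm (V : Form) : TField 1 := fun x I => V x (I 0)
def ofTensor2 (h : Tensor2) : TField 2 := fun x I => h x (I 0) (I 1)

/-- Every contraction of a slot with the normal vanishes. -/
def Tangential {k : ℕ} (T : TField k) : Prop :=
  ∀ (x : S2) (a : Fin k) (I : Fin k → Fin 3),
    ∑ j : Fin 3, (x : E3) j * T x (Function.update I a j) = 0

/-- `T` is of class `C^n` on the sphere: its radially constant extension is of class `C^n`
away from the origin. -/
def IsOfClass (n : WithTop ℕ∞) {k : ℕ} (T : TField k) : Prop :=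
  ContDiffOn ℝ n (fun y : E3 => T (radial y)) {0}ᶜ

/-- The matrix `x xᵀ` of the normal projection at `x`. -/
def normalMat (x : S2) : Matrix (Fin 3) (Fin 3) ℝ :=
  Matrix.of fun i j => (x : E3) i * (x : E3) j

/-- The round unit metric, `1 - x xᵀ`. -/
def round : Tensor2 := fun x => 1 - normalMat x

/-- The `i`-th Cartesian component of the (tangential) gradient of a function on the sphere. -/
def pd (i : Fin 3) (f : Scalar) (x : S2) : ℝ :=
  fderiv ℝ (fun y : E3 => f (radial y)) (x : E3) (EuclideanSpace.single i 1)

/-- The Levi-Civita covariant derivative of the round unit metric: the tangential projection of the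
derivative of the components. The index of differentiation comes first. -/
def cov {k : ℕ} (T : TField k) : TField (k + 1) := fun x I =>
  ∑ J : Fin k → Fin 3,
    (∏ a : Fin k, round x (I a.succ) (J a)) * pd (I 0) (fun y => T y J) x

/-! ### Sobolev norms with respect to the round unit metric -/

/-- `S` is the weak covariant derivative of `T`. -/
def IsWeakCov {k : ℕ} (T : TField k) (S : TField (k + 1)) : Prop :=
  MeasureTheory.Integrable T area ∧ MeasureTheory.Integrable S area ∧ Tangential S ∧
    ∀ Φ : TField (k + 1), IsOfClass ∞ Φ → Tangential Φ →
      ∫ x, ∑ I, S x I * Φ x I ∂area =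
        -∫ x, ∑ J, T x J * ∑ i : Fin 3, cov Φ x (Fin.cons i (Fin.cons i J)) ∂area

/-- The norm of `H^m`: the square root of the sum of the squared `L^2` norms of the weak covariant
derivatives of order `0, …, m`, and infinity if one of them does not exist. (Weak derivatives are
unique almost everywhere, so that the infimum runs over at most one value.) -/
def sobolevNorm (m : ℕ) {k : ℕ} (T : TField k) : ℝ≥0∞ :=
  ⨅ (F : ∀ i : ℕ, TField (k + i)) (_ : F 0 = T) (_ : ∀ i < m, IsWeakCov (F i) (F (i + 1))),
    (∑ i ∈ Finset.range (m + 1), ∫⁻ x, ENNReal.ofReal (∑ I, F i x I ^ 2) ∂area) ^ (1 / 2 : ℝ)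

/-- `T` is a tangential tensor field in `H^m`, for `2 ≤ m`. On a surface each `H^m` class has
exactly one representative of class `C^(m-2)`; classes are identified with this representative. -/
def InH (m : ℕ) {k : ℕ} (T : TField k) : Prop :=
  Tangential T ∧ IsOfClass ((m - 2 : ℕ) : WithTop ℕ∞) T ∧ sobolevNorm m T < ⊤

/-! ### Differential operators of the round unit metric -/

/-- The differential of a function. -/
def dS (f : Scalar) : Form := fun x i => cov (ofScalar f) x ![i]

/-- `nabla1 V x i j` is the component `∇_i V_j`. -/
def nabla1 (V : Form) (x : S2) (i j : Fin 3) : ℝ := cov (ofForm V) x ![i, j]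

/-- `nabla2 h x i j k` is the component `∇_i h_jk`. -/
def nabla2 (h : Tensor2) (x : S2) (i j k : Fin 3) : ℝ := cov (ofTensor2 h) x ![i, j, k]

/-- The divergence of a one-form. -/
def divR (V : Form) : Scalar := fun x => ∑ i, nabla1 V x i i

/-- The Laplace-Beltrami operator. -/
def lap (f : Scalar) : Scalar := divR (dS f)

/-- The Hodge dual `(*V)_i = ε_ij V_j` of a one-form, where `ε` is the area form of the sphere
oriented by the outer normal: in ambient components, the vector product `V × x`. -/
def hodge (V : Form) : Form := fun x => crossProduct (V x) (fun i => (x : E3) i)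

/-- The Hodge operator `-(1/2) (∇_i V_j + ∇_j V_i - (div V) γ_ij)`. -/
def D2star (V : Form) : Tensor2 := fun x => Matrix.of fun i j =>
  -(1 / 2) * (nabla1 V x i j + nabla1 V x j i - divR V x * round x i j)

/-- The trace-free part of a two-tensor with respect to the round unit metric. -/
def tracefreeR (W : Tensor2) : Tensor2 := fun x => W x - ((W x).trace / 2) • round x

/-! ### Spherical harmonics -/

/-- Legendre polynomials, by the formula of Rodrigues. -/
def legendreP (l : ℕ) : Polynomial ℝ :=
  Polynomial.C (1 / (2 ^ l * (l.factorial : ℝ))) *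
    Polynomial.derivative^[l] ((Polynomial.X ^ 2 - 1) ^ l)

/-- The azimuthal factor times `sin^|m| θ`: the real or imaginary part of `(x + i y)^|m|`. -/
def azimuthal (m : ℤ) (x : S2) : ℝ :=
  if m = 0 then 1
  else if 0 < m then Real.sqrt 2 * ((⟨(x : E3) 0, (x : E3) 1⟩ : ℂ) ^ m.natAbs).re
  else Real.sqrt 2 * ((⟨(x : E3) 0, (x : E3) 1⟩ : ℂ) ^ m.natAbs).im

/-- The standard real-valued orthonormal spherical harmonics, for `|m| ≤ l`. -/
def Y (l : ℕ) (m : ℤ) : Scalar := fun x =>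
  Real.sqrt ((2 * l + 1) / (4 * Real.pi) *
      (((l - m.natAbs).factorial : ℝ) / ((l + m.natAbs).factorial : ℝ))) *
    (Polynomial.derivative^[m.natAbs] (legendreP l)).eval ((x : E3) 2) * azimuthal m x

/-- Electric and magnetic one-form harmonics, for `1 ≤ l`. -/
def YE (l : ℕ) (m : ℤ) : Form := fun x => -(1 / Real.sqrt (l * (l + 1))) • dS (Y l m) x
def YH (l : ℕ) (m : ℤ) : Form := fun x => (1 / Real.sqrt (l * (l + 1))) • hodge (dS (Y l m)) x

/-- Electric and magnetic two-tensor harmonics, for `2 ≤ l`. -/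
def Ypsi (l : ℕ) (m : ℤ) : Tensor2 := fun x =>
  (1 / Real.sqrt (1 / 2 * (l * (l + 1)) - 1)) • D2star (YE l m) x
def Yphi (l : ℕ) (m : ℤ) : Tensor2 := fun x =>
  (1 / Real.sqrt (1 / 2 * (l * (l + 1)) - 1)) • D2star (YH l m) x

/-- The harmonic coefficients of functions, one-forms and two-tensors. -/
def coeff (f : Scalar) (l : ℕ) (m : ℤ) : ℝ := ∫ x, f x * Y l m x ∂area
def coeffE (V : Form) (l : ℕ) (m : ℤ) : ℝ := ∫ x, ∑ i, V x i * YE l m x i ∂area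
def coeffH (V : Form) (l : ℕ) (m : ℤ) : ℝ := ∫ x, ∑ i, V x i * YH l m x i ∂area
def coeffPsi (W : Tensor2) (l : ℕ) (m : ℤ) : ℝ :=
  ∫ x, ∑ i, ∑ j, W x i j * Ypsi l m x i j ∂area
def coeffPhi (W : Tensor2) (l : ℕ) (m : ℤ) : ℝ :=
  ∫ x, ∑ i, ∑ j, W x i j * Yphi l m x i j ∂area

/-- The modes of degree `l < L`. -/
def modesLT (L : ℕ) (f : Scalar) : Scalar := fun x =>
  ∑ l ∈ Finset.range L, ∑ m ∈ Finset.Icc (-(l : ℤ)) l, coeff f l m * Y l m x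
def formModesLT (L : ℕ) (V : Form) : Form := fun x =>
  ∑ l ∈ Finset.Ico 1 L, ∑ m ∈ Finset.Icc (-(l : ℤ)) l,
    (coeffE V l m • YE l m x + coeffH V l m • YH l m x)
def tensorModesLT (L : ℕ) (W : Tensor2) : Tensor2 := fun x =>
  ∑ l ∈ Finset.Ico 2 L, ∑ m ∈ Finset.Icc (-(l : ℤ)) l,
    (coeffPsi W l m • Ypsi l m x + coeffPhi W l m • Yphi l m x)

/-- The modes of degree `L ≤ l`: since the harmonics are complete in the square-integrable
functions, one-forms and trace-free symmetric two-tensors, this is what is left when the finitely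
many modes of degree `l < L` are removed. A part of a two-tensor that is pure trace with respect to
the round metric has no modes. -/
def modesGE (L : ℕ) (f : Scalar) : Scalar := fun x => f x - modesLT L f x
def formModesGE (L : ℕ) (V : Form) : Form := fun x => V x - formModesLT L V x
def tensorModesGE (L : ℕ) (W : Tensor2) : Tensor2 := fun x =>
  tracefreeR W x - tensorModesLT L W x

/-! ### Geometry of a Riemannian metric `g` on the sphere -/

/-- `g` is a Riemannian metric (its tangentiality is part of `InH`). -/
def IsMetric (g : Tensor2) : Prop :=
  ∀ x, (g x).IsSymm ∧ ∀ V : Fin 3 → ℝ, ∑ i, V i * (x : E3) i = 0 → V ≠ 0 →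
    0 < ∑ i, ∑ j, g x i j * V i * V j

/-- The conformal factor `φ` with `g = φ^2 g_c` and `det g_c = det γ`. The determinant of `g`
relative to the round metric `γ` is that of the matrix `g + x xᵀ`. -/
def confFactor (g : Tensor2) : Scalar := fun x => (g x + normalMat x).det ^ (1 / 4 : ℝ)

/-- The representative `g_c` of the conformal class of `g`. -/
def confClass (g : Tensor2) : Tensor2 := fun x => (confFactor g x ^ 2)⁻¹ • g x

/-- The inverse metric, a tangential tensor. -/
def ginv (g : Tensor2) : Tensor2 := fun x => (g x + normalMat x)⁻¹ - normalMat x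

/-- Symmetric and trace-free with respect to `g`. -/
def IsSymmTracefree (g h : Tensor2) : Prop :=
  ∀ x, (h x).IsSymm ∧ ∑ i, ∑ j, ginv g x i j * h x i j = 0

/-- The difference `C^d_ab` of the Levi-Civita connections of `g` and of the round metric. -/
def conn (g : Tensor2) (x : S2) (d a b : Fin 3) : ℝ :=
  1 / 2 * ∑ e, ginv g x d e * (nabla2 g x a b e + nabla2 g x b a e - nabla2 g x e a b)

/-- The covariant derivatives `∇_a V_b` and `∇_c h_ab` of the Levi-Civita connection of `g`. -/
def gnabla1 (g : Tensor2) (V : Form) (x : S2) (a b : Fin 3) : ℝ :=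
  nabla1 V x a b - ∑ d, conn g x d a b * V x d
def gnabla2 (g h : Tensor2) (x : S2) (c a b : Fin 3) : ℝ :=
  nabla2 h x c a b - ∑ d, conn g x d c a * h x d b - ∑ d, conn g x d c b * h x a d

/-- The divergences of one-forms and of symmetric two-tensors with respect to `g`. -/
def gdiv1 (g : Tensor2) (V : Form) : Scalar := fun x =>
  ∑ a, ∑ b, ginv g x a b * gnabla1 g V x a b
def gdiv2 (g h : Tensor2) : Form := fun x a =>
  ∑ b, ∑ c, ginv g x b c * gnabla2 g h x c b a

/-- The trace-free symmetrised derivative `∇_a V_b + ∇_b V_a - (div V) g_ab`. -/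
def gNablaHat (g : Tensor2) (V : Form) : Tensor2 := fun x => Matrix.of fun a b =>
  gnabla1 g V x a b + gnabla1 g V x b a - gdiv1 g V x * g x a b

/-- The product `(h, k) = g^ac g^bd h_ab k_cd` and the contraction `(h · V)_a = h_ab g^bc V_c`. -/
def gInner (g h k : Tensor2) : Scalar := fun x =>
  ∑ a, ∑ b, ∑ c, ∑ d, ginv g x a c * ginv g x b d * h x a b * k x c d
def gContract (g h : Tensor2) (V : Form) : Form := fun x a =>
  ∑ b, ∑ c, h x a b * ginv g x b c * V x c

/-- The Ricci tensor of `g`, computed from that of the round unit metric (which is the round metric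
itself) and from the difference tensor `C`:
`Ric_bd = γ_bd + ∇_a C^a_db - ∇_d C^a_ab + C^a_ae C^e_db - C^a_de C^e_ab`. -/
def ricci (g : Tensor2) : Tensor2 := fun x => Matrix.of fun b d =>
  round x b d
    + ∑ a, cov (k := 3) (fun y I => conn g y (I 0) (I 1) (I 2)) x ![a, a, d, b]
    - nabla1 (fun y c => ∑ a, conn g y a a c) x d b
    + ∑ a, ∑ e, (conn g x a a e * conn g x e d b - conn g x a d e * conn g x e a b)

/-- The Gauss curvature of `g`, half of its scalar curvature. -/
def gaussCurvature (g : Tensor2) : Scalar := fun x =>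
  1 / 2 * ∑ b, ∑ d, ginv g x b d * ricci g x b d

/-! ### Sphere data -/

/-- The components `(Ω, g, Ω tr χ, χ-hat, Ω tr χ-bar, χ-bar-hat, η, ω, D ω, ω-bar, D-bar ω-bar,
α, α-bar)` of `C^2`-sphere data. -/
@[ext] structure C2Data where
  Om : Scalar
  g : Tensor2
  OmTrChi : Scalar
  chih : Tensor2
  OmTrChib : Scalar
  chibh : Tensor2
  eta : Form
  om : Scalar
  Dom : Scalar
  omb : Scalar
  Dbomb : Scalar
  al : Tensor2
  alb : Tensor2

/-- The components of `C^3`-sphere data: those of `C^2`-sphere data together with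
`(D^2 ω, D-bar^2 ω-bar, D-hat α, D-bar-hat α-bar)`. -/
@[ext] structure C3Data where
  toC2 : C2Data
  D2om : Scalar
  Db2omb : Scalar
  Dal : Tensor2
  Dbalb : Tensor2

instance : Sub C2Data where
  sub X Z :=
    { Om := X.Om - Z.Om
      g := X.g - Z.g
      OmTrChi := X.OmTrChi - Z.OmTrChi
      chih := X.chih - Z.chih
      OmTrChib := X.OmTrChib - Z.OmTrChib
      chibh := X.chibh - Z.chibh
      eta := X.eta - Z.eta
      om := X.om - Z.om
      Dom := X.Dom - Z.Dom
      omb := X.omb - Z.omb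
      Dbomb := X.Dbomb - Z.Dbomb
      al := X.al - Z.al
      alb := X.alb - Z.alb }

instance : Sub C3Data where
  sub X Z :=
    { toC2 := X.toC2 - Z.toC2
      D2om := X.D2om - Z.D2om
      Db2omb := X.Db2omb - Z.Db2omb
      Dal := X.Dal - Z.Dal
      Dbalb := X.Dbalb - Z.Dbalb }

/-- Reference Minkowski sphere data. -/
def minkowski (v : ℝ) : C3Data where
  toC2 :=
    { Om := fun _ => 1
      g := fun x => v ^ 2 • round x
      OmTrChi := fun _ => 2 / v
      chih := 0
      OmTrChib := fun _ => -(2 / v)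
      chibh := 0
      eta := 0
      om := 0
      Dom := 0
      omb := 0
      Dbomb := 0
      al := 0
      alb := 0 }
  D2om := 0
  Db2omb := 0
  Dal := 0
  Dbalb := 0

/-- The norm of `X^k` on `C^2`-sphere data. -/
def c2Norm (k : ℕ) (X : C2Data) : ℝ≥0∞ :=
  sobolevNorm k (ofScalar X.Om) + sobolevNorm k (ofTensor2 X.g)
    + sobolevNorm k (ofScalar X.OmTrChi) + sobolevNorm k (ofTensor2 X.chih)
    + sobolevNorm (k - 2) (ofScalar X.OmTrChib) + sobolevNorm (k - 2) (ofTensor2 X.chibh)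
    + sobolevNorm (k - 1) (ofForm X.eta)
    + sobolevNorm k (ofScalar X.om) + sobolevNorm k (ofScalar X.Dom)
    + sobolevNorm (k - 2) (ofScalar X.omb) + sobolevNorm (k - 4) (ofScalar X.Dbomb)
    + sobolevNorm k (ofTensor2 X.al) + sobolevNorm (k - 4) (ofTensor2 X.alb)

/-- The norm on `C^3`-sphere data. -/
def c3Norm (X : C3Data) : ℝ≥0∞ :=
  c2Norm 8 X.toC2 + sobolevNorm 8 (ofScalar X.D2om) + sobolevNorm 2 (ofScalar X.Db2omb)
    + sobolevNorm 8 (ofTensor2 X.Dal) + sobolevNorm 2 (ofTensor2 X.Dbalb)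

/-- `C^2`-sphere data of regularity `X^k`: the lapse is positive, `g` is a Riemannian metric, and
the components that are trace-free symmetric tensors are so with respect to `g`. -/
structure IsC2SphereData (k : ℕ) (X : C2Data) : Prop where
  Om_pos : ∀ x, 0 < X.Om x
  g_metric : IsMetric X.g
  chih_tf : IsSymmTracefree X.g X.chih
  chibh_tf : IsSymmTracefree X.g X.chibh
  al_tf : IsSymmTracefree X.g X.al
  alb_tf : IsSymmTracefree X.g X.alb
  Om_mem : InH k (ofScalar X.Om)
  g_mem : InH k (ofTensor2 X.g)
  OmTrChi_mem : InH k (ofScalar X.OmTrChi)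
  chih_mem : InH k (ofTensor2 X.chih)
  OmTrChib_mem : InH (k - 2) (ofScalar X.OmTrChib)
  chibh_mem : InH (k - 2) (ofTensor2 X.chibh)
  eta_mem : InH (k - 1) (ofForm X.eta)
  om_mem : InH k (ofScalar X.om)
  Dom_mem : InH k (ofScalar X.Dom)
  omb_mem : InH (k - 2) (ofScalar X.omb)
  Dbomb_mem : InH (k - 4) (ofScalar X.Dbomb)
  al_mem : InH k (ofTensor2 X.al)
  alb_mem : InH (k - 4) (ofTensor2 X.alb)

/-- `C^3`-sphere data of finite norm. -/
structure IsC3SphereData (X : C3Data) : Prop where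
  c2 : IsC2SphereData 8 X.toC2
  Dal_tf : IsSymmTracefree X.toC2.g X.Dal
  Dbalb_tf : IsSymmTracefree X.toC2.g X.Dbalb
  D2om_mem : InH 8 (ofScalar X.D2om)
  Db2omb_mem : InH 2 (ofScalar X.Db2omb)
  Dal_mem : InH 8 (ofTensor2 X.Dal)
  Dbalb_mem : InH 2 (ofTensor2 X.Dbalb)

/-! ### Matching data -/

/-- `(Ω tr χ - (4/v) Ω)` -/
def lapseCombination (v : ℝ) (X : C2Data) : Scalar := fun x => X.OmTrChi x - 4 / v * X.Om x

/-- The divergence, with respect to the round unit metric, of the `l = 1` modes of `η`. -/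
def divEta1 (X : C2Data) : Scalar := divR (formModesLT 2 X.eta)

/-- The matching quantity built from the modes `l ≤ 1` of `ω-bar`. -/
def Qomb (u v : ℝ) (X : C2Data) : Scalar := fun x =>
  modesLT 2 X.omb x + 1 / 4 * modesLT 2 X.OmTrChib x - 1 / (6 * (v - u)) * divEta1 X x
    - 1 / (12 * v ^ 3) *
      (lap (modesLT 2 (lapseCombination v X)) x + 3 * modesLT 2 (lapseCombination v X) x)
    - 1 / (2 * v ^ 2) *
      (lap (modesLT 2 (confFactor X.g)) x + 2 * modesLT 2 (confFactor X.g) x)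

/-- The matching quantity built from the modes `l ≤ 1` of `D-bar ω-bar`. -/
def QDbomb (u v : ℝ) (X : C2Data) : Scalar :=
  let F : Scalar := modesLT 2 fun x => 1 / v * X.OmTrChib x
    - 2 / v ^ 3 * (lap (confFactor X.g) x + 2 * confFactor X.g x)
  let A : Scalar := modesLT 2 (lapseCombination v X)
  fun x => modesLT 2 X.Dbomb x - 1 / 6 * (lap F x - 3 * F x)
    + 1 / (6 * (v - u)) * (lap (lap A) x + lap A x - 3 * A x)
    - 2 / (3 * v ^ 2) * divEta1 X x

/-- The matching quantity built from the modes `l ≤ 1` of `D-bar^2 ω-bar`. -/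
def QDb2omb (v : ℝ) (X : C3Data) : Scalar :=
  let F : Scalar := modesLT 2 fun x => 1 / v ^ 2 * X.toC2.OmTrChib x
    - 2 / v ^ 4 * (lap (confFactor X.toC2.g) x + 2 * confFactor X.toC2.g x)
  let A : Scalar := modesLT 2 (lapseCombination v X.toC2)
  fun x => modesLT 2 X.Db2omb x - 1 / 2 * (lap F x - 3 * F x)
    + 1 / (2 * v ^ 2) * (lap (lap A) x + 2 * lap A x - 3 * A x)
    - 1 / v ^ 3 * divEta1 X.toC2 x

/-- The values of the `C^2`-matching map. -/
structure C2Matching where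
  Om : Scalar
  phi : Scalar
  gc : Tensor2
  OmTrChi : Scalar
  chih : Tensor2
  OmTrChibGE2 : Scalar
  chibh : Tensor2
  etaGE2 : Form
  om : Scalar
  Dom : Scalar
  ombGE2 : Scalar
  DbombGE2 : Scalar
  Qomb : Scalar
  QDbomb : Scalar
  al : Tensor2
  alb : Tensor2

/-- The values of the `C^3`-matching map. -/
structure C3Matching where
  toC2 : C2Matching
  D2om : Scalar
  Db2ombGE2 : Scalar
  QDb2omb : Scalar
  Dal : Tensor2
  DbalbGE3 : Tensor2

/-- The `C^2`-matching map on the sphere `S_{u,v}`. -/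
def c2Match (u v : ℝ) (X : C2Data) : C2Matching where
  Om := X.Om
  phi := confFactor X.g
  gc := confClass X.g
  OmTrChi := X.OmTrChi
  chih := X.chih
  OmTrChibGE2 := modesGE 2 X.OmTrChib
  chibh := X.chibh
  etaGE2 := formModesGE 2 X.eta
  om := X.om
  Dom := X.Dom
  ombGE2 := modesGE 2 X.omb
  DbombGE2 := modesGE 2 X.Dbomb
  Qomb := Qomb u v X
  QDbomb := QDbomb u v X
  al := X.al
  alb := X.alb

/-- The matching map on the sphere `S_{u,v}`. -/
def matchingMap (u v : ℝ) (X : C3Data) : C3Matching where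
  toC2 := c2Match u v X.toC2
  D2om := X.D2om
  Db2ombGE2 := modesGE 2 X.Db2omb
  QDb2omb := QDb2omb v X
  Dal := X.Dal
  DbalbGE3 := tensorModesGE 3 X.Dbalb

/-! ### Charges -/

/-- `tr χ` and `tr χ-bar`. -/
def trChi (X : C2Data) : Scalar := fun x => X.OmTrChi x / X.Om x
def trChib (X : C2Data) : Scalar := fun x => X.OmTrChib x / X.Om x

/-- The torsion `ζ = η - d log Ω`. -/
def zeta (X : C2Data) : Form := fun x => X.eta x - dS (fun y => Real.log (X.Om y)) x

/-- The curvature component `ρ`, given by the Gauss equation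
`K + (1/4) tr χ tr χ-bar - (1/2) (χ-hat, χ-bar-hat) = -ρ`. -/
def rho (X : C2Data) : Scalar := fun x =>
  -(gaussCurvature X.g x + 1 / 4 * trChi X x * trChib X x - 1 / 2 * gInner X.g X.chih X.chibh x)

/-- The curvature component `β`, given by the Codazzi equation
`div χ-hat - (1/2) d tr χ + χ-hat · ζ - (1/2) tr χ ζ = -β`. -/
def beta (X : C2Data) : Form := fun x =>
  -(gdiv2 X.g X.chih x - (1 / 2 : ℝ) • dS (trChi X) x + gContract X.g X.chih (zeta X) x
    - (1 / 2 * trChi X x) • zeta X x)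

/-- The function `φ^3 (ρ + φ div β)`. -/
def energyDensity (X : C2Data) : Scalar := fun x =>
  confFactor X.g x ^ 3 * (rho X x + confFactor X.g x * gdiv1 X.g (beta X) x)

/-- The one-form `φ^3 (d tr χ + tr χ (η - d log Ω))`. -/
def momentumDensity (X : C2Data) : Form := fun x =>
  confFactor X.g x ^ 3 • (dS (trChi X) x + trChi X x • zeta X x)

/-- The two-tensor `φ⁻¹ D-bar-hat α-bar + φ⁻² (1 + φ² ∇-hat div) α-bar`. -/
def thirdOrderDensity (X : C3Data) : Tensor2 := fun x =>
  (1 / confFactor X.toC2.g x) • X.Dbalb x + (1 / confFactor X.toC2.g x ^ 2) •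
    (X.toC2.alb x + confFactor X.toC2.g x ^ 2 •
      gNablaHat X.toC2.g (gdiv2 X.toC2.g X.toC2.alb) x)

/-- The twenty charges. The index `m` of `P`, `L`, `G` runs through `-1, 0, 1`, and that of `U`, `V`
through `-2, …, 2`. -/
structure Charges where
  E : ℝ
  P : Fin 3 → ℝ
  L : Fin 3 → ℝ
  G : Fin 3 → ℝ
  U : Fin 5 → ℝ
  V : Fin 5 → ℝ

def charges (X : C3Data) : Charges where
  E := -(1 / (8 * Real.pi)) * Real.sqrt (4 * Real.pi) * coeff (energyDensity X.toC2) 0 0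
  P := fun m => -(1 / (8 * Real.pi)) * Real.sqrt (4 * Real.pi / 3) *
    coeff (energyDensity X.toC2) 1 ((m : ℤ) - 1)
  L := fun m => 1 / (16 * Real.pi) * Real.sqrt (8 * Real.pi / 3) *
    coeffH (momentumDensity X.toC2) 1 ((m : ℤ) - 1)
  G := fun m => 1 / (16 * Real.pi) * Real.sqrt (8 * Real.pi / 3) *
    coeffE (momentumDensity X.toC2) 1 ((m : ℤ) - 1)
  U := fun m => coeffPsi (thirdOrderDensity X) 2 ((m : ℤ) - 2)
  V := fun m => coeffPhi (thirdOrderDensity X) 2 ((m : ℤ) - 2)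

end NullGluing

end

/-!
Two data with the same matching data and the same charges can differ only in finitely many modes.
The charges control these modes because each of them is, on the remaining difference, a harmonic
coefficient with a weight of fixed sign.

The one-form `η` may differ by `V` in the span of `E^{1m}` and `H^{1m}`. The difference of the
momentum densities is `φ³ tr χ V`, so that equality of `L` and `G` makes it orthogonal to this span,
and in particular `∫ φ³ tr χ |V|² = 0`. The same argument, with the weight `-φ³ tr χ / (4 Ω)` from
the Gauss equation, recovers the modes `l ≤ 1` of `Ω tr χ-bar` from `E` and `P`, as `β` depends on
`η` but not on `Ω tr χ-bar`. The three matching quantities then determine the low modes of `ω-bar`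
and of its derivatives. For `D-bar-hat α-bar` the weight is `1 / φ`; the charges `U` and `V`
determine its trace-free part with respect to the round metric, and the remaining multiple of the
round metric vanishes since it is trace-free with respect to `g`. The common mechanism is
`eq_zero_of_weighted_coeff_eq`.

Smallness is needed only for the sign of `tr χ`, that is, for a pointwise bound of `Ω tr χ - 2 / v`
by its Sobolev norm (`exists_sup_le_sobolevNorm`). The norm is defined by weak derivatives, and the
bound is obtained by testing them: with `t` the cosine of the distance from a point `p` and `s > 1`,
the function `log (s - t)` has the Laplacian `(s² - 1) / (s - t)² - 1` (`laplacian_log`), in which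
the first term is a multiple of an approximate identity at `p` as `s → 1`. Hence `f p` is bounded by
the mean of `f` and by the pairing of the second weak derivative of `f` with `log (s - t)`, which
is bounded in `L²` uniformly in `s`. The total mass of the kernel and the `L²` bound both follow from
`∫ Δh = 0` (`integral_sum_pd_pd`), for `h = log (s - t)` and `h = √(s - t)` respectively. This
identity is deduced from integration by parts in space and polar coordinates.
-/

noncomputable section

namespace NullGluing

/-! ### Calculus on the sphere -/

lemma radial_coe (x : S2) : radial (x : E3) = x := by
  have h1 : ‖(x : E3)‖ = 1 := by simp
  have h0 : (x : E3) ≠ 0 := by rintro h; simp [h] at h1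
  apply Subtype.ext
  simp [radial, h0, h1]

lemma S2.coe_ne_zero (x : S2) : (x : E3) ≠ 0 := by
  have h1 : ‖(x : E3)‖ = 1 := by simp
  rintro h; simp [h] at h1

lemma S2.sum_sq (x : S2) : ∑ i, (x : E3) i * (x : E3) i = 1 := by
  have h1 : ‖(x : E3)‖ = 1 := by simp
  have := EuclideanSpace.real_norm_sq_eq (x : E3)
  rw [h1] at this
  simp only [← pow_two, ← this]; norm_num

lemma coe_radial {y : E3} (h : y ≠ 0) : (radial y : E3) = ‖y‖⁻¹ • y := by
  simp [radial, h]

lemma radial_smul {c : ℝ} (hc : 0 < c) (y : E3) : radial (c • y) = radial y := by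
  by_cases h : y = 0
  · simp [h]
  · have h' : c • y ≠ 0 := smul_ne_zero hc.ne' h
    apply Subtype.ext
    rw [coe_radial h, coe_radial h', norm_smul, smul_smul, Real.norm_of_nonneg hc.le]
    congr 1
    field_simp

lemma contDiffOn_radial {n : WithTop ℕ∞} :
    ContDiffOn ℝ n (fun y : E3 => (radial y : E3)) {0}ᶜ := by
  have : ContDiffOn ℝ n (fun y : E3 => ‖y‖⁻¹ • y) {0}ᶜ := by
    intro y hy
    have hy : y ≠ 0 := hy
    exact (((contDiffAt_norm ℝ hy).inv (norm_ne_zero_iff.2 hy)).smul contDiffAt_id).contDiffWithinAt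
  exact this.congr fun y hy => coe_radial hy

/-- A function on the sphere is of class `C^n` if its radially constant extension is so away from
the origin. -/
def SmoothS (n : WithTop ℕ∞) (f : Scalar) : Prop :=
  ContDiffOn ℝ n (fun y : E3 => f (radial y)) {0}ᶜ

namespace SmoothS
variable {n m : WithTop ℕ∞} {f g : Scalar}

lemma of_le (h : SmoothS n f) (hm : m ≤ n) : SmoothS m f := ContDiffOn.of_le h hm

lemma const (c : ℝ) : SmoothS n fun _ => c := contDiffOn_const

lemma coord (i : Fin 3) : SmoothS n fun x => (x : E3) i :=
  (EuclideanSpace.proj (𝕜 := ℝ) i).contDiff.comp_contDiffOn contDiffOn_radial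

lemma add (hf : SmoothS n f) (hg : SmoothS n g) : SmoothS n fun x => f x + g x :=
  ContDiffOn.add hf hg

lemma sub (hf : SmoothS n f) (hg : SmoothS n g) : SmoothS n fun x => f x - g x :=
  ContDiffOn.sub hf hg

lemma neg (hf : SmoothS n f) : SmoothS n fun x => -f x := ContDiffOn.neg hf

lemma mul (hf : SmoothS n f) (hg : SmoothS n g) : SmoothS n fun x => f x * g x :=
  ContDiffOn.mul hf hg

lemma pow (hf : SmoothS n f) (k : ℕ) : SmoothS n fun x => f x ^ k := ContDiffOn.pow hf k

lemma inv (hf : SmoothS n f) (h : ∀ x, f x ≠ 0) : SmoothS n fun x => (f x)⁻¹ :=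
  ContDiffOn.inv hf fun _ _ => h _

lemma div (hf : SmoothS n f) (hg : SmoothS n g) (h : ∀ x, g x ≠ 0) : SmoothS n fun x => f x / g x :=
  ContDiffOn.div hf hg fun _ _ => h _

lemma log (hf : SmoothS n f) (h : ∀ x, f x ≠ 0) : SmoothS n fun x => Real.log (f x) :=
  ContDiffOn.log hf fun _ _ => h _

lemma rpow (hf : SmoothS n f) (p : ℝ) (h : ∀ x, f x ≠ 0) : SmoothS n fun x => f x ^ p :=
  ContDiffOn.rpow_const_of_ne hf fun _ _ => h _

lemma sum {ι : Type*} (s : Finset ι) {F : ι → Scalar} (h : ∀ i ∈ s, SmoothS n (F i)) :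
    SmoothS n fun x => ∑ i ∈ s, F i x := ContDiffOn.sum h

lemma prod {ι : Type*} (s : Finset ι) {F : ι → Scalar} (h : ∀ i ∈ s, SmoothS n (F i)) :
    SmoothS n fun x => ∏ i ∈ s, F i x := contDiffOn_prod h

protected lemma continuous (hf : SmoothS n f) : Continuous f := by
  have h : Continuous fun x : S2 => f (radial (x : E3)) :=
    (ContDiffOn.continuousOn hf).comp_continuous continuous_subtype_val fun x => S2.coe_ne_zero x
  simpa only [radial_coe] using h

lemma differentiableAt (hf : SmoothS n f) (hn : 1 ≤ n) {y : E3} (hy : y ≠ 0) :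
    DifferentiableAt ℝ (fun y : E3 => f (radial y)) y :=
  (hf.of_le hn).differentiableOn one_ne_zero |>.differentiableAt (isOpen_compl_singleton.mem_nhds hy)

/-- Each Cartesian component of the gradient loses one derivative. -/
protected lemma pd (hf : SmoothS n f) (i : Fin 3) (hm : m + 1 ≤ n) : SmoothS m (pd i f) := by
  have h1 : ContDiffOn ℝ m (fderiv ℝ fun y : E3 => f (radial y)) {0}ᶜ :=
    ContDiffOn.fderiv_of_isOpen hf isOpen_compl_singleton hm
  have h2 := (h1.comp contDiffOn_radial fun y _ => S2.coe_ne_zero (radial y)).clm_apply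
    (contDiffOn_const (c := (EuclideanSpace.single i 1 : E3)))
  exact h2

end SmoothS

lemma pd_add {f g : Scalar} (hf : SmoothS 1 f) (hg : SmoothS 1 g) (i : Fin 3) (x : S2) :
    pd i (fun x => f x + g x) x = pd i f x + pd i g x := by
  have := fderiv_fun_add (hf.differentiableAt le_rfl x.coe_ne_zero)
    (hg.differentiableAt le_rfl x.coe_ne_zero)
  simp [pd, this]

lemma pd_mul {f g : Scalar} (hf : SmoothS 1 f) (hg : SmoothS 1 g) (i : Fin 3) (x : S2) :
    pd i (fun x => f x * g x) x = f x * pd i g x + pd i f x * g x := by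
  have := fderiv_fun_mul (hf.differentiableAt le_rfl x.coe_ne_zero)
    (hg.differentiableAt le_rfl x.coe_ne_zero)
  simp [pd, this, radial_coe]
  ring

/-- The gradient of a composition `h ∘ f`. -/
lemma pd_comp {f : Scalar} (hf : SmoothS 1 f) {h : ℝ → ℝ} {h' : ℝ} (i : Fin 3) (x : S2)
    (hh : HasDerivAt h h' (f x)) : pd i (fun x => h (f x)) x = h' * pd i f x := by
  have h1 := (hf.differentiableAt le_rfl x.coe_ne_zero).hasFDerivAt
  rw [← radial_coe x] at hh
  have h2 := (hh.comp_hasFDerivAt (x : E3) h1).fderiv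
  simp only [Function.comp_def] at h2
  simp [pd, h2]

lemma pd_const (c : ℝ) (i : Fin 3) (x : S2) : pd i (fun _ => c) x = 0 := by
  simp [pd]

/-- The derivative of a radially constant function is homogeneous of degree `-1`. -/
lemma fderiv_comp_radial_smul (f : Scalar) {c : ℝ} (hc : 0 < c) (y : E3) :
    fderiv ℝ (fun z : E3 => f (radial z)) (c • y) =
      c⁻¹ • fderiv ℝ (fun z : E3 => f (radial z)) y := by
  have h := fderiv_comp_smul (𝕜 := ℝ) (f := fun z : E3 => f (radial z)) (x := y) c
  simp only [radial_smul hc] at h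
  rw [h, smul_smul, inv_mul_cancel₀ hc.ne', one_smul]

/-- The derivative of the radially constant extension, away from the sphere. -/
lemma fderiv_comp_radial (f : Scalar) (i : Fin 3) {y : E3} (hy : y ≠ 0) :
    fderiv ℝ (fun z : E3 => f (radial z)) y (EuclideanSpace.single i 1) =
      ‖y‖⁻¹ * pd i f (radial y) := by
  have h := fderiv_comp_radial_smul f (norm_pos_iff.2 hy) (radial y : E3)
  have h2 : ‖y‖ • (radial y : E3) = y := by
    rw [coe_radial hy, smul_smul, mul_inv_cancel₀ (norm_ne_zero_iff.2 hy), one_smul]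
  rw [h2] at h
  simp [h, pd]

/-- The gradient is tangential. -/
lemma sum_coord_mul_pd (f : Scalar) (x : S2) : ∑ i, (x : E3) i * pd i f x = 0 := by
  by_cases hd : DifferentiableAt ℝ (fun y : E3 => f (radial y)) x
  · have h1 : ∑ i, (x : E3) i * pd i f x
        = fderiv ℝ (fun y : E3 => f (radial y)) (x : E3) (x : E3) := by
      have h := congrArg (fderiv ℝ (fun y : E3 => f (radial y)) (x : E3))
        ((EuclideanSpace.basisFun (Fin 3) ℝ).sum_repr (x : E3))
      rw [map_sum] at h
      simpa [pd] using h
    rw [h1]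
    have hc : HasDerivAt (fun t : ℝ => t • (x : E3)) (x : E3) 1 := by
      simpa using (hasDerivAt_id (1 : ℝ)).smul_const (x : E3)
    have hd' : HasFDerivAt (fun y : E3 => f (radial y))
        (fderiv ℝ (fun y : E3 => f (radial y)) (x : E3)) ((1 : ℝ) • (x : E3)) := by
      simpa using hd.hasFDerivAt
    have h2 := hd'.comp_hasDerivAt (1 : ℝ) hc
    have h3 : HasDerivAt ((fun y : E3 => f (radial y)) ∘ fun t : ℝ => t • (x : E3)) 0 1 := by
      refine (hasDerivAt_const (1 : ℝ) (f x)).congr_of_eventuallyEq ?_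
      filter_upwards [lt_mem_nhds (zero_lt_one (α := ℝ))] with t ht
      simp [radial_smul ht, radial_coe]
    exact h2.unique h3
  · simp [pd, fderiv_zero_of_not_differentiableAt hd]

lemma round_apply (x : S2) (i j : Fin 3) :
    round x i j = (if i = j then 1 else 0) - (x : E3) i * (x : E3) j := by
  simp [round, normalMat, Matrix.one_apply]

lemma round_comm (x : S2) (i j : Fin 3) : round x i j = round x j i := by
  simp only [round_apply, eq_comm (a := i), mul_comm]

lemma sum_round_mul_coord (x : S2) (i : Fin 3) : ∑ j, round x i j * (x : E3) j = 0 := by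
  have h := S2.sum_sq x
  simp only [round_apply, sub_mul, Finset.sum_sub_distrib, mul_assoc, ← Finset.mul_sum, h]
  simp

lemma sum_coord_mul_round (x : S2) (i : Fin 3) : ∑ j, (x : E3) j * round x j i = 0 := by
  rw [← sum_round_mul_coord x i]
  exact Finset.sum_congr rfl fun j _ => by rw [round_comm, mul_comm]

/-- The gradients of the coordinate functions are the columns of the tangential projection. -/
lemma pd_coord (i j : Fin 3) (x : S2) : pd i (fun x => (x : E3) j) x = round x i j := by
  have hx : ‖(x : E3)‖ = 1 := by simp
  have h1 : HasFDerivAt (fun y : E3 => ‖y‖ ^ 2) (2 • innerSL ℝ (x : E3)) (x : E3) :=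
    (hasStrictFDerivAt_norm_sq (x : E3)).hasFDerivAt
  have h2 : HasDerivAt (fun z : ℝ => (√z)⁻¹) (-(1 / 2)) (‖(x : E3)‖ ^ 2) := by
    have := (Real.hasDerivAt_sqrt (x := ‖(x : E3)‖ ^ 2) (by simp)).inv (by simp)
    refine this.congr_deriv ?_
    simp
  have h3 := (h2.comp_hasFDerivAt (x : E3) h1).mul
    (EuclideanSpace.proj j : E3 →L[ℝ] ℝ).hasFDerivAt
  have h4 : (fun y : E3 => (radial y : E3) j) =ᶠ[nhds (x : E3)]
      ((fun z : ℝ => (√z)⁻¹) ∘ fun y : E3 => ‖y‖ ^ 2) *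
        (EuclideanSpace.proj j : E3 →L[ℝ] ℝ) := by
    filter_upwards [isOpen_compl_singleton.mem_nhds x.coe_ne_zero] with y hy
    simp [coe_radial hy]
  rw [pd, (h3.congr_of_eventuallyEq h4).fderiv, round_apply]
  simp [hx, PiLp.inner_apply, eq_comm]
  ring

/-! ### The divergence theorem -/

instance : MeasureTheory.IsFiniteMeasure area := by unfold area; infer_instance
instance : MeasureTheory.Measure.IsOpenPosMeasure area := by unfold area; infer_instance

open MeasureTheory in
/-- Integration in polar coordinates. -/
lemma integral_mul_comp_radial (a : ℝ → ℝ) (g : Scalar) :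
    ∫ y : E3, a ‖y‖ * g (radial y) =
      (∫ x, g x ∂area) * ∫ r : Set.Ioi (0 : ℝ), a r ∂Measure.volumeIoiPow 2 := by
  have hdim : Module.finrank ℝ E3 - 1 = 2 := by simp
  have h1 : ∫ y : E3, a ‖y‖ * g (radial y) =
      ∫ y : ({(0 : E3)}ᶜ : Set E3), a ‖y.1‖ * g (radial y.1) ∂(Measure.comap Subtype.val volume) := by
    rw [integral_subtype_comap (measurableSet_singleton _).compl fun y : E3 ↦ a ‖y‖ * g (radial y),
      restrict_compl_singleton]
  have h2 := (volume : Measure E3).measurePreserving_homeomorphUnitSphereProd.integral_comp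
    (Homeomorph.measurableEmbedding _) fun p : S2 × Set.Ioi (0 : ℝ) => g p.1 * a p.2
  rw [h1, area, ← hdim, ← integral_prod_mul, ← h2]
  refine integral_congr_ae (Filter.Eventually.of_forall fun y => ?_)
  have hy : (y : E3) ≠ 0 := y.2
  have : ((homeomorphUnitSphereProd E3) y).1 = radial y := by
    apply Subtype.ext
    rw [coe_radial hy]
    simp
  simp [this, mul_comm]

/-- A smooth bump function on the line, supported in `[1, 3]`. It is applied to `|y|²`, which gives a
radial cutoff in space that avoids the origin, where radially constant extensions are singular. -/
def cutoff : ContDiffBump (2 : ℝ) := ⟨1 / 2, 1, by norm_num, by norm_num⟩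

lemma contDiff_cutoff : ContDiff ℝ 1 fun y : E3 => cutoff (‖y‖ ^ 2) :=
  cutoff.contDiff.comp (contDiff_norm_sq ℝ)

lemma tsupport_cutoff_subset :
    tsupport (fun y : E3 => cutoff (‖y‖ ^ 2)) ⊆ {y | 1 ≤ ‖y‖ ^ 2} ∩ Metric.closedBall 0 2 := by
  refine closure_minimal ?_ ((isClosed_le continuous_const (by fun_prop)).inter
    Metric.isClosed_closedBall)
  intro y hy
  have : ‖y‖ ^ 2 ∈ Metric.ball (2 : ℝ) 1 := by
    have : ‖y‖ ^ 2 ∈ Function.support cutoff := hy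
    rwa [cutoff.support_eq] at this
  rw [Real.ball_eq_Ioo] at this
  refine ⟨?_, ?_⟩
  · have := this.1; simp only [Set.mem_ofPred_eq]; linarith
  · have := this.2
    rw [mem_closedBall_zero_iff]
    nlinarith [norm_nonneg y]

lemma hasCompactSupport_cutoff : HasCompactSupport fun y : E3 => cutoff (‖y‖ ^ 2) :=
  (isCompact_closedBall (0 : E3) 2).of_isClosed_subset (isClosed_tsupport _)
    fun _ hy => (tsupport_cutoff_subset hy).2

lemma ne_zero_of_mem_tsupport_cutoff {y : E3}
    (hy : y ∈ tsupport fun y : E3 => cutoff (‖y‖ ^ 2)) : y ≠ 0 := by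
  rintro rfl
  have := (tsupport_cutoff_subset hy).1
  simp at this
  linarith

lemma continuous_cutoff_mul {h : E3 → ℝ} (hh : ContinuousOn h {0}ᶜ) :
    Continuous fun y : E3 => cutoff (‖y‖ ^ 2) * h y := by
  refine continuous_of_tsupport fun y hy => ?_
  have hy0 := ne_zero_of_mem_tsupport_cutoff (tsupport_mul_subset_left hy)
  exact contDiff_cutoff.continuous.continuousAt.mul
    (hh.continuousAt (isOpen_compl_singleton.mem_nhds hy0))

/-- Integration by parts in space against a radial cutoff, read in polar coordinates: it relates the
integrals of `∂_i g` and of `x_i g` over the sphere, up to two radial integrals. -/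
lemma integral_pd_cutoff {g : Scalar} (hg : SmoothS 1 g) (i : Fin 3) :
    (∫ x, pd i g x ∂area) *
        ∫ r : Set.Ioi (0 : ℝ), cutoff ((r : ℝ) ^ 2) * (r : ℝ)⁻¹ ∂MeasureTheory.Measure.volumeIoiPow 2
      = -((∫ x, (x : E3) i * g x ∂area) * ∫ r : Set.Ioi (0 : ℝ),
          2 * (r : ℝ) * deriv cutoff ((r : ℝ) ^ 2) ∂MeasureTheory.Measure.volumeIoiPow 2) := by
  rw [← integral_mul_comp_radial (fun r => cutoff (r ^ 2) * r⁻¹),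
    ← integral_mul_comp_radial (fun r => 2 * r * deriv cutoff (r ^ 2)) fun x => (x : E3) i * g x]
  have hd : ∀ y : E3, fderiv ℝ (fun y : E3 => cutoff (‖y‖ ^ 2)) y (EuclideanSpace.single i 1) =
      2 * y i * deriv cutoff (‖y‖ ^ 2) := by
    intro y
    have h1 : HasFDerivAt (fun y : E3 => ‖y‖ ^ 2) (2 • innerSL ℝ y) y :=
      (hasStrictFDerivAt_norm_sq y).hasFDerivAt
    have h2 : HasDerivAt cutoff (deriv cutoff (‖y‖ ^ 2)) (‖y‖ ^ 2) :=
      ((cutoff.contDiff (n := 1)).differentiable one_ne_zero _).hasDerivAt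
    have h3 := (h2.comp_hasFDerivAt y h1).fderiv
    simp only [Function.comp_def] at h3
    simp [h3, PiLp.inner_apply]
    ring
  have hcont : ContinuousOn (fun y : E3 => g (radial y)) {0}ᶜ := ContDiffOn.continuousOn hg
  have hcont' : ContinuousOn (fun y : E3 =>
      fderiv ℝ (fun y : E3 => g (radial y)) y (EuclideanSpace.single i 1)) {0}ᶜ :=
    (ContDiffOn.continuousOn_fderiv_of_isOpen hg isOpen_compl_singleton le_rfl).clm_apply
      continuousOn_const
  have key := integral_mul_fderiv_eq_neg_fderiv_mul_of_integrable
    (μ := (MeasureTheory.volume : MeasureTheory.Measure E3))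
    (f := fun y : E3 => cutoff (‖y‖ ^ 2)) (g := fun y : E3 => g (radial y))
    (v := EuclideanSpace.single i 1) ?_ ?_ ?_ ?_ ?_
  · have e1 : ∫ y : E3, cutoff (‖y‖ ^ 2) * ‖y‖⁻¹ * pd i g (radial y) =
        ∫ y : E3, cutoff (‖y‖ ^ 2) *
          fderiv ℝ (fun y : E3 => g (radial y)) y (EuclideanSpace.single i 1) := by
      refine MeasureTheory.integral_congr_ae (Filter.Eventually.of_forall fun y => ?_)
      by_cases hy : y ∈ tsupport fun y : E3 => cutoff (‖y‖ ^ 2)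
      · simp only [fderiv_comp_radial g i (ne_zero_of_mem_tsupport_cutoff hy)]
        ring
      · have h0 : (fun y : E3 => cutoff (‖y‖ ^ 2)) y = 0 := 
          image_eq_zero_of_notMem_tsupport (f := fun y : E3 => cutoff (‖y‖ ^ 2)) hy
        simp only at h0
        simp [h0]
    rw [e1, key]
    congr 1
    refine MeasureTheory.integral_congr_ae (Filter.Eventually.of_forall fun y => ?_)
    simp only [hd]
    by_cases hy : y = 0
    · simp [hy]
    · rw [coe_radial hy]
      have := norm_ne_zero_iff.2 hy
      simp only [PiLp.smul_apply, smul_eq_mul]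
      field_simp
  · refine Continuous.integrable_of_hasCompactSupport ?_ ?_
    · have hc' : Continuous fun y : E3 =>
          fderiv ℝ (fun y : E3 => cutoff (‖y‖ ^ 2)) y (EuclideanSpace.single i 1) :=
        (contDiff_cutoff.continuous_fderiv one_ne_zero).clm_apply continuous_const
      refine continuous_of_tsupport fun y hy => ?_
      have hy0 : y ≠ 0 := by
        refine ne_zero_of_mem_tsupport_cutoff ?_
        exact tsupport_fderiv_apply_subset ℝ _ (tsupport_mul_subset_left hy)
      exact hc'.continuousAt.mul (hcont.continuousAt (isOpen_compl_singleton.mem_nhds hy0))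
    · exact (hasCompactSupport_cutoff.fderiv_apply ℝ _).mul_right
  · exact (continuous_cutoff_mul hcont').integrable_of_hasCompactSupport
      hasCompactSupport_cutoff.mul_right
  · exact (continuous_cutoff_mul hcont).integrable_of_hasCompactSupport
      hasCompactSupport_cutoff.mul_right
  · exact fun y _ => contDiff_cutoff.differentiable one_ne_zero y
  · exact fun y hy => hg.differentiableAt le_rfl (ne_zero_of_mem_tsupport_cutoff hy)

lemma area_real_univ_pos : 0 < area.real Set.univ := by
  have : Nonempty S2 := ⟨⟨_, pole_mem⟩⟩
  rw [MeasureTheory.measureReal_def]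
  exact ENNReal.toReal_pos (isOpen_univ.measure_ne_zero _ Set.univ_nonempty)
    (MeasureTheory.measure_ne_top _ _)

lemma _root_.Continuous.integrable_area {f : Scalar} (hf : Continuous f) :
    MeasureTheory.Integrable f area :=
  hf.integrable_of_hasCompactSupport (HasCompactSupport.of_compactSpace f)

lemma SmoothS.integrable {n : WithTop ℕ∞} {f : Scalar} (hf : SmoothS n f) :
    MeasureTheory.Integrable f area := hf.continuous.integrable_area

/-- The divergence theorem for a constant ambient vector field, whose normal part contributes the
mean curvature term. -/
lemma integral_pd {g : Scalar} (hg : SmoothS 1 g) (i : Fin 3) :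
    ∫ x, pd i g x ∂area = 2 * ∫ x, (x : E3) i * g x ∂area := by
  set B := ∫ r : Set.Ioi (0 : ℝ), cutoff ((r : ℝ) ^ 2) * (r : ℝ)⁻¹
    ∂MeasureTheory.Measure.volumeIoiPow 2 with hB
  set A := ∫ r : Set.Ioi (0 : ℝ), 2 * (r : ℝ) * deriv cutoff ((r : ℝ) ^ 2)
    ∂MeasureTheory.Measure.volumeIoiPow 2 with hA
  have hBpos : B ≠ 0 := by
    have h1 := integral_mul_comp_radial (fun r => cutoff (r ^ 2) * r⁻¹) fun _ => 1
    have h2 : 0 < ∫ y : E3, cutoff (‖y‖ ^ 2) * ‖y‖⁻¹ * 1 := by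
      simp only [mul_one]
      refine Continuous.integral_pos_of_hasCompactSupport_nonneg_nonzero
        (x := EuclideanSpace.single 0 (√2)) (continuous_cutoff_mul ?_)
        hasCompactSupport_cutoff.mul_right ?_ ?_
      · exact continuous_norm.continuousOn.inv₀ fun y hy => norm_ne_zero_iff.2 hy
      · exact fun y => mul_nonneg cutoff.nonneg (inv_nonneg.2 (norm_nonneg y))
      · have : cutoff 2 = 1 := cutoff.one_of_mem_closedBall (by simp [cutoff])
        simp [this]
    rw [h1] at h2
    intro h0
    rw [← hB, h0] at h2
    simp at h2
  -- The ratio of the two radial integrals is found by testing with the coordinate functions.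
  have hAB : A = -2 * B := by
    have h1 : ∀ j : Fin 3, (∫ x, (1 - (x : E3) j * (x : E3) j) ∂area) * B =
        -((∫ x, (x : E3) j * (x : E3) j ∂area) * A) := by
      intro j
      have := integral_pd_cutoff (SmoothS.coord (n := 1) j) j
      simpa only [pd_coord, round_apply, if_true] using this
    have hint : ∀ j : Fin 3, MeasureTheory.Integrable (fun x : S2 => (x : E3) j * (x : E3) j) area :=
      fun j => ((SmoothS.coord (n := 1) j).mul (SmoothS.coord j)).integrable
    have h2 : ∑ j : Fin 3, ∫ x : S2, (x : E3) j * (x : E3) j ∂area = area.real Set.univ := by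
      rw [← MeasureTheory.integral_finsetSum _ fun j _ => hint j]
      simp [S2.sum_sq]
    have h3 : ∀ j : Fin 3, ∫ x : S2, (1 - (x : E3) j * (x : E3) j) ∂area =
        area.real Set.univ - ∫ x : S2, (x : E3) j * (x : E3) j ∂area := by
      intro j
      rw [MeasureTheory.integral_sub (MeasureTheory.integrable_const _) (hint j)]
      simp
    have h4 := Finset.sum_congr (rfl : (Finset.univ : Finset (Fin 3)) = _) fun j _ => h1 j
    simp only [h3, ← Finset.sum_mul, Finset.sum_neg_distrib, Finset.sum_sub_distrib, h2] at h4
    have := area_real_univ_pos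
    simp at h4
    have h5 : area.real Set.univ * (A + 2 * B) = 0 := by linear_combination h4
    rcases mul_eq_zero.1 h5 with h | h
    · exact absurd h this.ne'
    · linarith
  have h := integral_pd_cutoff hg i
  rw [← hA, ← hB, hAB] at h
  exact mul_right_cancel₀ hBpos (h.trans (by ring))

/-- The Laplacian in ambient components has vanishing integral. -/
lemma integral_sum_pd_pd {g : Scalar} (hg : SmoothS 2 g) :
    ∫ x, ∑ i, pd i (pd i g) x ∂area = 0 := by
  have h1 : ∀ i, SmoothS 1 (pd i g) := fun i => hg.pd i (by norm_num)
  have h0 : ∀ i, SmoothS 0 (pd i (pd i g)) := fun i => (h1 i).pd i (by norm_num)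
  rw [MeasureTheory.integral_finsetSum _ fun i _ => (h0 i).integrable]
  simp only [integral_pd (h1 _)]
  rw [← Finset.mul_sum, ← MeasureTheory.integral_finsetSum _ fun i _ =>
    ((SmoothS.coord i).mul (h1 i)).integrable]
  simp [sum_coord_mul_pd]

/-! ### Testing weak derivatives with smooth functions -/

lemma sum_fin_succ_fun {k : ℕ} {M : Type*} [AddCommMonoid M] (F : (Fin (k + 1) → Fin 3) → M) :
    ∑ I, F I = ∑ i, ∑ J, F (Fin.cons i J) := by
  rw [← (Fin.consEquiv fun _ => Fin 3).sum_comp, Fintype.sum_prod_type]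
  rfl

lemma sum_fin_zero_fun {M : Type*} [AddCommMonoid M] (F : (Fin 0 → Fin 3) → M) :
    ∑ I, F I = F ![] := by
  rw [Fintype.sum_unique]
  congr 1

/-- Projecting the gradient changes nothing, as it is tangential. -/
lemma sum_round_mul_pd (f : Scalar) (x : S2) (j : Fin 3) :
    ∑ i, round x j i * pd i f x = pd j f x := by
  simp only [round_apply, sub_mul, Finset.sum_sub_distrib, mul_assoc, ← Finset.mul_sum,
    sum_coord_mul_pd]
  simp

lemma sum_round_mul_round (x : S2) (i j : Fin 3) :
    ∑ k, round x i k * round x k j = round x i j := by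
  simpa only [pd_coord] using sum_round_mul_pd (fun y => (y : E3) j) x i

lemma sum_round_diag (x : S2) : ∑ i, round x i i = 2 := by
  have := S2.sum_sq x
  simp only [round_apply, Finset.sum_sub_distrib, this]
  norm_num

namespace SmoothS

lemma round {n : WithTop ℕ∞} (i j : Fin 3) : SmoothS n fun x => round x i j := by
  simp only [round_apply]
  exact (const _).sub ((coord i).mul (coord j))

end SmoothS

lemma cov_one_apply (Φ : TField 1) (x : S2) (i j : Fin 3) :
    cov Φ x (Fin.cons i (Fin.cons j ![])) =
      ∑ b, round x j b * pd i (fun y => Φ y ![b]) x := by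
  simp only [cov, sum_fin_succ_fun, sum_fin_zero_fun]
  simp

lemma cov_two_apply (Φ : TField 2) (x : S2) (i j k : Fin 3) :
    cov Φ x (Fin.cons i (Fin.cons j (Fin.cons k ![]))) =
      ∑ b, ∑ c, round x j b * round x k c *
        pd i (fun y => Φ y ![b, c]) x := by
  simp only [cov, sum_fin_succ_fun, sum_fin_zero_fun]
  simp [Fin.prod_univ_succ]

lemma pd_round (i a b : Fin 3) (x : S2) : pd i (fun y => round y a b) x =
    -((x : E3) a * round x i b + round x i a * (x : E3) b) := by
  have h1 : pd i (fun y => (y : E3) a * (y : E3) b) x =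
      (x : E3) a * round x i b + round x i a * (x : E3) b := by
    rw [pd_mul (SmoothS.coord a) (SmoothS.coord b), pd_coord, pd_coord]
  have h2 : pd i (fun y => round y a b + (y : E3) a * (y : E3) b) x = 0 := by
    simp only [round_apply, sub_add_cancel]
    exact pd_const _ i x
  rw [pd_add (SmoothS.round a b) ((SmoothS.coord a).mul (SmoothS.coord b)), h1] at h2
  linarith

/-- The divergence of `G γ` is the differential of `G`. -/
lemma sum_cov_mul_round {G : Scalar} (hG : SmoothS 1 G) (x : S2) (j : Fin 3) :
    ∑ i, cov (k := 2) (fun y I => G y * round y (I 0) (I 1)) x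
      (Fin.cons i (Fin.cons i (Fin.cons j ![]))) = pd j G x := by
  simp only [cov_two_apply]
  have h1 : ∀ i b c : Fin 3, pd i (fun y => G y * round y (![b, c] 0) (![b, c] 1)) x =
      pd i G x * round x b c -
      G x * ((x : E3) b * round x i c + round x i b * (x : E3) c) := by
    intro i b c
    simp only [Matrix.cons_val_zero, Matrix.cons_val_one]
    rw [pd_mul hG (SmoothS.round b c), pd_round]
    ring
  simp only [h1]
  have h2 : ∀ i b : Fin 3, ∑ c, round x i b * round x j c *
      (pd i G x * round x b c -
        G x * ((x : E3) b * round x i c + round x i b * (x : E3) c)) =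
      round x i b * round x b j * pd i G x
        - round x i b * (x : E3) b * (G x * round x i j) := by
    intro i b
    have e1 := sum_round_mul_round x j b
    have e2 := sum_round_mul_round x j i
    have e3 := sum_round_mul_coord x j
    calc _ = round x i b * pd i G x * ∑ c, round x j c * round x c b
          - round x i b * (x : E3) b * G x *
            ∑ c, round x j c * round x c i
          - round x i b * round x i b * G x *
            ∑ c, round x j c * (x : E3) c := by
          simp only [Finset.mul_sum, ← Finset.sum_sub_distrib]
          refine Finset.sum_congr rfl fun c _ => ?_
          rw [round_comm x c b, round_comm x c i]; ring
      _ = _ := by rw [e1, e2, e3, round_comm x j b, round_comm x j i]; ring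
  simp only [h2, Finset.sum_sub_distrib, ← Finset.sum_mul, sum_round_mul_round,
    sum_round_mul_coord]
  simp only [zero_mul, Finset.sum_const_zero, sub_zero, round_comm x _ j, sum_round_mul_pd]

/-- The divergence of `dG` in ambient components: the projections in the covariant derivative drop
out of the trace. -/
lemma sum_cov_pd (G : Scalar) (x : S2) :
    ∑ i, cov (k := 1) (fun y I => pd (I 0) G y) x (Fin.cons i (Fin.cons i ![])) =
      ∑ i, pd i (pd i G) x := by
  simp only [cov_one_apply, Matrix.cons_val_zero]
  rw [Finset.sum_comm]
  refine Finset.sum_congr rfl fun b _ => ?_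
  have := sum_round_mul_pd (pd b G) x b
  simp only [round_comm x _ b]
  exact this

open MeasureTheory in
/-- Two weak derivatives suffice to move the Laplacian from a smooth function to `f`. -/
lemma integral_mul_laplacian {f : Scalar} {S : TField 1} {T : TField 2}
    (hS : IsWeakCov (ofScalar f) S) (hT : IsWeakCov S T) {G : Scalar} (hG : SmoothS ∞ G) :
    ∫ x, f x * ∑ i, pd i (pd i G) x ∂area =
      ∫ x, (∑ I, T x I * round x (I 0) (I 1)) * G x ∂area := by
  -- The second weak derivative is tested with `G γ` and the first one with `dG`.
  have h1 := hT.2.2.2 (fun y I => G y * round y (I 0) (I 1))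
    (contDiffOn_pi.2 fun I => hG.mul (SmoothS.round _ _)) (by
      intro x a I
      fin_cases a
      · simp only [Fin.zero_eta, Function.update_self, ne_eq, one_ne_zero, not_false_eq_true,
          Function.update_of_ne]
        have := sum_coord_mul_round x (I 1)
        calc _ = G x * ∑ j, (x : E3) j * round x j (I 1) := by
              rw [Finset.mul_sum]; exact Finset.sum_congr rfl fun j _ => by ring
          _ = 0 := by rw [this, mul_zero]
      · simp only [Fin.mk_one, Function.update_self, ne_eq, zero_ne_one, not_false_eq_true,
          Function.update_of_ne]
        have := sum_round_mul_coord x (I 0)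
        calc _ = G x * ∑ j, round x (I 0) j * (x : E3) j := by
              rw [Finset.mul_sum]; exact Finset.sum_congr rfl fun j _ => by ring
          _ = 0 := by rw [this, mul_zero])
  have h2 := hS.2.2.2 (fun y I => pd (I 0) G y)
    (contDiffOn_pi.2 fun I => hG.pd (I 0) (by simp)) (by
      intro x a I
      fin_cases a
      simpa using sum_coord_mul_pd G x)
  simp only [sum_fin_succ_fun (k := 0), sum_fin_zero_fun] at h1 h2
  simp only [sum_cov_mul_round (hG.of_le (by simp)), sum_cov_pd] at h1 h2
  simp only [Fin.cons_zero] at h1 h2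
  rw [h2, neg_neg] at h1
  rw [show (∫ x, f x * ∑ i, pd i (pd i G) x ∂area) =
    ∫ x, ofScalar f x ![] * ∑ i, pd i (pd i G) x ∂area from rfl, ← h1]
  refine integral_congr_ae (Filter.Eventually.of_forall fun x => ?_)
  simp only [Finset.sum_mul]
  exact Finset.sum_congr rfl fun j _ => by ring

/-! ### The regularised logarithmic Green's function -/

/-- The Laplacian of a composition `h ∘ f`. -/
lemma sum_pd_pd_comp {f : Scalar} (hf : SmoothS 2 f) {h h' h'' : ℝ → ℝ}
    (hh : ∀ x, HasDerivAt h (h' (f x)) (f x)) (hh' : ∀ x, HasDerivAt h' (h'' (f x)) (f x))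
    (hs : SmoothS 1 fun x => h' (f x)) (x : S2) :
    ∑ i, pd i (pd i fun x => h (f x)) x =
      h'' (f x) * ∑ i, pd i f x * pd i f x + h' (f x) * ∑ i, pd i (pd i f) x := by
  have hf1 : SmoothS 1 f := hf.of_le (by norm_num)
  have e : ∀ i, pd i (fun x => h (f x)) = fun x => h' (f x) * pd i f x := fun i =>
    funext fun x => pd_comp hf1 i x (hh x)
  simp only [e, Finset.mul_sum, ← Finset.sum_add_distrib]
  refine Finset.sum_congr rfl fun i _ => ?_
  rw [pd_mul hs (hf.pd i (by norm_num)), pd_comp hf1 i x (hh' x)]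
  ring

/-- The cosine of the spherical distance from `p`. -/
def cosDist (p x : S2) : ℝ := ∑ i, (p : E3) i * (x : E3) i

lemma cosDist_smooth (p : S2) {n : WithTop ℕ∞} : SmoothS n (cosDist p) :=
  SmoothS.sum _ fun i _ => (SmoothS.const _).mul (SmoothS.coord i)

lemma dist_sq_eq (p x : S2) : dist x p ^ 2 = 2 - 2 * cosDist p x := by
  have h1 := S2.sum_sq p
  have h2 := S2.sum_sq x
  rw [Subtype.dist_eq, EuclideanSpace.dist_eq, Real.sq_sqrt (by positivity)]
  simp only [Real.dist_eq, sq_abs, cosDist, Fin.sum_univ_three] at *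
  linear_combination h1 + h2

lemma cosDist_le_one (p x : S2) : cosDist p x ≤ 1 := by
  nlinarith [dist_sq_eq p x, sq_nonneg (dist x p)]

lemma neg_one_le_cosDist (p x : S2) : -1 ≤ cosDist p x := by
  have h1 := S2.sum_sq p
  have h2 := S2.sum_sq x
  simp only [cosDist, Fin.sum_univ_three] at *
  nlinarith [sq_nonneg ((p : E3) 0 + (x : E3) 0), sq_nonneg ((p : E3) 1 + (x : E3) 1),
    sq_nonneg ((p : E3) 2 + (x : E3) 2)]

lemma pd_cosDist (p : S2) (i : Fin 3) (x : S2) :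
    pd i (cosDist p) x = (p : E3) i - cosDist p x * (x : E3) i := by
  have e : ∀ j, pd i (fun x : S2 => (p : E3) j * (x : E3) j) x = (p : E3) j * round x i j := by
    intro j
    rw [pd_mul (SmoothS.const _) (SmoothS.coord j), pd_coord, pd_const]
    ring
  have e2 : pd i (cosDist p) x = ∑ j, (p : E3) j * round x i j := by
    simp only [← e, Fin.sum_univ_three]
    rw [← pd_add ((SmoothS.const _).mul (SmoothS.coord 0)) ((SmoothS.const _).mul (SmoothS.coord 1)),
      ← pd_add (((SmoothS.const _).mul (SmoothS.coord 0)).add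
        ((SmoothS.const _).mul (SmoothS.coord 1))) ((SmoothS.const _).mul (SmoothS.coord 2))]
    congr 1
    funext y
    simp only [cosDist, Fin.sum_univ_three]
  rw [e2]
  simp only [round_apply, mul_sub, Finset.sum_sub_distrib, cosDist, Finset.sum_mul]
  congr 1
  · simp
  · exact Finset.sum_congr rfl fun j _ => by ring

/-- The Laplacian of a zonal function `h (s - cos d)`, where `d` is the distance from `p`. -/
lemma laplacian_zonal (p : S2) (s : ℝ) {h h' h'' : ℝ → ℝ}
    (hh : ∀ x, HasDerivAt h (h' (s - cosDist p x)) (s - cosDist p x))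
    (hh' : ∀ x, HasDerivAt h' (h'' (s - cosDist p x)) (s - cosDist p x))
    (hs : SmoothS 1 fun x => h' (s - cosDist p x)) (x : S2) :
    ∑ i, pd i (pd i fun x => h (s - cosDist p x)) x =
      h'' (s - cosDist p x) * (1 - cosDist p x ^ 2) + h' (s - cosDist p x) * (2 * cosDist p x) := by
  have hu : SmoothS 2 fun x => s - cosDist p x := (SmoothS.const s).sub (cosDist_smooth p)
  have hp := S2.sum_sq p
  have hx := S2.sum_sq x
  have e1 : ∀ i, pd i (fun x => s - cosDist p x) =
      fun x : S2 => -(p : E3) i + cosDist p x * (x : E3) i := by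
    intro i
    funext x
    have := pd_comp (h := fun z => s - z) (cosDist_smooth p) i x
      ((hasDerivAt_id (cosDist p x)).const_sub s)
    rw [this, pd_cosDist]
    ring
  have e2 : ∀ i, pd i (fun x : S2 => -(p : E3) i + cosDist p x * (x : E3) i) x =
      cosDist p x * round x i i + ((p : E3) i - cosDist p x * (x : E3) i) * (x : E3) i := by
    intro i
    rw [pd_add (SmoothS.const _) ((cosDist_smooth p).mul (SmoothS.coord i)), pd_const,
      pd_mul (cosDist_smooth p) (SmoothS.coord i), pd_coord, pd_cosDist]
    ring
  rw [sum_pd_pd_comp hu hh hh' hs]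
  simp only [e1, e2]
  have hr := sum_round_diag x
  congr 2
  · have ht : cosDist p x = ∑ i, (p : E3) i * (x : E3) i := rfl
    simp only [Fin.sum_univ_three] at *
    linear_combination hp + cosDist p x ^ 2 * hx - 2 * cosDist p x * (-ht)
  · have ht : cosDist p x = ∑ i, (p : E3) i * (x : E3) i := rfl
    simp only [Fin.sum_univ_three] at *
    linear_combination cosDist p x * hr - cosDist p x * hx - ht

section zonal
variable (p : S2) {s : ℝ} (hs : 1 < s)
include hs

lemma sub_cosDist_pos (x : S2) : 0 < s - cosDist p x := by
  linarith [cosDist_le_one p x]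

omit hs in
lemma smooth_sub_cosDist {n : WithTop ℕ∞} : SmoothS n fun x => s - cosDist p x :=
  (SmoothS.const s).sub (cosDist_smooth p)

lemma smooth_log_sub_cosDist {n : WithTop ℕ∞} : SmoothS n fun x => Real.log (s - cosDist p x) :=
  (smooth_sub_cosDist p).log fun x => (sub_cosDist_pos p hs x).ne'

/-- The regularised logarithm is, up to a constant, a Green's function: its Laplacian is an
approximate identity minus a constant. -/
lemma laplacian_log (x : S2) :
    ∑ i, pd i (pd i fun x => Real.log (s - cosDist p x)) x =
      (s ^ 2 - 1) * ((s - cosDist p x) ^ 2)⁻¹ - 1 := by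
  have hpos := sub_cosDist_pos p hs
  rw [laplacian_zonal p s (h' := fun u => u⁻¹) (h'' := fun u => -(u ^ 2)⁻¹)
    (fun x => Real.hasDerivAt_log (hpos x).ne') (fun x => hasDerivAt_inv (hpos x).ne')
    ((smooth_sub_cosDist p).inv fun x => (hpos x).ne')]
  have := (hpos x).ne'
  field_simp
  ring

/-- A uniform bound for a singular integral: the Laplacian of the square root integrates to
zero. -/
lemma integral_inv_sqrt_le (hs2 : s ≤ 2) :
    ∫ x, (√(s - cosDist p x))⁻¹ ∂area ≤ 3 * area.real Set.univ := by
  have hpos := sub_cosDist_pos p hs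
  have hu := smooth_sub_cosDist p (s := s) (n := 2)
  have hsq : SmoothS 2 fun x => √(s - cosDist p x) := by
    simp only [Real.sqrt_eq_rpow]
    exact hu.rpow _ fun x => (hpos x).ne'
  have hsqpos : ∀ x, 0 < √(s - cosDist p x) := fun x => Real.sqrt_pos.2 (hpos x)
  have hinv : SmoothS 2 fun x => (√(s - cosDist p x))⁻¹ := hsq.inv fun x => (hsqpos x).ne'
  -- Pointwise, the Laplacian of the square root dominates its inverse up to a constant.
  have hlap : ∀ x, ∑ i, pd i (pd i fun x => √(s - cosDist p x)) x ≥
      1 / 2 * (√(s - cosDist p x))⁻¹ - 3 / 2 := by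
    intro x
    rw [laplacian_zonal p s (h' := fun u => 1 / (2 * √u))
      (h'' := fun u => -(1 / 4) * (√u)⁻¹ ^ 3)
      (fun x => Real.hasDerivAt_sqrt (hpos x).ne') (fun x => ?_) ?_]
    · have h0 := hsqpos x
      have h1 := Real.sq_sqrt (hpos x).le
      set w := √(s - cosDist p x)
      have ht : cosDist p x = s - w ^ 2 := by linarith
      have hw3 : w ^ 2 ≤ 4 := by linarith [neg_one_le_cosDist p x]
      have hw2 : w ≤ 2 := by nlinarith
      rw [ht, ge_iff_le, ← sub_nonneg]
      have e : -(1 / 4) * w⁻¹ ^ 3 * (1 - (s - w ^ 2) ^ 2) + 1 / (2 * w) * (2 * (s - w ^ 2)) -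
          (1 / 2 * w⁻¹ - 3 / 2) =
          (2 * (s - 1) * w ^ 2 + (s ^ 2 - 1) + 3 * w ^ 3 * (2 - w)) / (4 * w ^ 3) := by
        field_simp
        ring
      rw [e]
      have : 0 ≤ s - 1 := by linarith
      have : 0 ≤ s ^ 2 - 1 := by nlinarith
      have : 0 ≤ 2 - w := by linarith
      positivity
    · refine (SmoothS.const 1).div ((SmoothS.const 2).mul (hsq.of_le (by norm_num))) ?_
      exact fun x => by have := hsqpos x; positivity
    · have h0 := hsqpos x
      have := ((Real.hasDerivAt_sqrt (hpos x).ne').const_mul 2).inv (by positivity)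
      simp only [one_div]
      refine this.congr_deriv ?_
      field_simp
      norm_num
  have hz := integral_sum_pd_pd hsq
  have hmono := MeasureTheory.integral_mono
    (μ := area) ((hinv.integrable.const_mul (1 / 2)).sub (MeasureTheory.integrable_const (3 / 2)))
    (SmoothS.integrable (SmoothS.sum Finset.univ fun i _ =>
      (hsq.pd i (m := 1) (by norm_num)).pd i (m := 0) (by norm_num))) hlap
  rw [hz] at hmono
  simp only [Pi.sub_apply] at hmono
  rw [MeasureTheory.integral_sub (hinv.integrable.const_mul (1 / 2))
    (MeasureTheory.integrable_const (3 / 2)), MeasureTheory.integral_const_mul] at hmono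
  simp at hmono
  linarith

omit hs in
/-- The logarithm of `u = w⁴` is `4 log w`, and `|log w| ≤ 1 / w` as long as `w ≤ 3 / 2`. -/
lemma log_sq_le {u : ℝ} (h0 : 0 < u) (h3 : u ≤ 3) : Real.log u ^ 2 ≤ 16 * (√u)⁻¹ := by
  have hw : 0 < √√u := by positivity
  have h1 : √√u ^ 2 = √u := Real.sq_sqrt (by positivity)
  have h2 : √u ^ 2 = u := Real.sq_sqrt h0.le
  have hlog : Real.log u = 4 * Real.log (√√u) := by
    rw [Real.log_sqrt (by positivity), Real.log_sqrt h0.le]; ring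
  set w := √√u
  have hw4 : w ^ 4 ≤ 3 := by
    calc w ^ 4 = (w ^ 2) ^ 2 := by ring
      _ = u := by rw [h1, h2]
      _ ≤ 3 := h3
  have hw2 : w ≤ 3 / 2 := by
    by_contra h
    push Not at h
    have : (3 / 2 : ℝ) ^ 4 < w ^ 4 := by gcongr
    norm_num at this
    linarith
  have hup : Real.log w ≤ w⁻¹ := by
    refine (Real.log_le_sub_one_of_pos hw).trans ?_
    rw [← one_div, le_div_iff₀ hw]
    nlinarith
  have hlo : -w⁻¹ ≤ Real.log w := by
    have := Real.log_le_sub_one_of_pos (inv_pos.2 hw)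
    rw [Real.log_inv] at this
    linarith
  have := sq_le_sq' hlo hup
  rw [hlog, ← h1, mul_pow]
  rw [inv_pow] at this
  linarith

/-- The regularised logarithms are bounded in `L²` uniformly in `s`. -/
lemma integral_log_sq_le (hs2 : s ≤ 2) :
    ∫ x, Real.log (s - cosDist p x) ^ 2 ∂area ≤ 48 * area.real Set.univ := by
  have hpos := sub_cosDist_pos p hs
  have hinv : SmoothS 2 fun x => (√(s - cosDist p x))⁻¹ := by
    simp only [Real.sqrt_eq_rpow]
    exact ((smooth_sub_cosDist p).rpow _ fun x => (hpos x).ne').inv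
      fun x => (Real.rpow_pos_of_pos (hpos x) _).ne'
  have h := MeasureTheory.integral_mono (μ := area)
    ((smooth_log_sub_cosDist p hs (n := 2)).pow 2).integrable
    (hinv.integrable.const_mul 16) fun x => log_sq_le (hpos x) (by linarith [neg_one_le_cosDist p x])
  rw [MeasureTheory.integral_const_mul] at h
  linarith [integral_inv_sqrt_le p hs hs2]

lemma smooth_kernel {n : WithTop ℕ∞} :
    SmoothS n fun x => (s ^ 2 - 1) * ((s - cosDist p x) ^ 2)⁻¹ :=
  (SmoothS.const _).mul (((smooth_sub_cosDist p).pow 2).inv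
    fun x => pow_ne_zero _ (sub_cosDist_pos p hs x).ne')

/-- The mass of the kernel does not depend on `s`, since the Laplacian of the logarithm integrates to
zero. -/
lemma integral_kernel :
    ∫ x, (s ^ 2 - 1) * ((s - cosDist p x) ^ 2)⁻¹ ∂area = area.real Set.univ := by
  have h := integral_sum_pd_pd (smooth_log_sub_cosDist p hs (n := 2))
  simp only [laplacian_log p hs] at h
  rw [MeasureTheory.integral_sub (smooth_kernel p hs (n := 0)).integrable
    (MeasureTheory.integrable_const _)] at h
  simp at h
  linarith

end zonal

/-! ### The Sobolev inequality -/

open MeasureTheory Filter Topology in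
/-- The kernels concentrate at `p`. -/
lemma tendsto_integral_kernel (p : S2) {f : Scalar} (hf : Continuous f) :
    Tendsto (fun s : ℝ => ∫ x, (s ^ 2 - 1) * ((s - cosDist p x) ^ 2)⁻¹ * f x ∂area) (𝓝[>] 1)
      (𝓝 (area.real Set.univ * f p)) := by
  have hm := area_real_univ_pos
  have h := tendsto_integral_peak_smul_of_integrable_of_tendsto (μ := area) (x₀ := p)
    (l := 𝓝[>] (1 : ℝ)) (t := Set.univ) (g := f) (a := f p)
    (φ := fun s x => (area.real Set.univ)⁻¹ * ((s ^ 2 - 1) * ((s - cosDist p x) ^ 2)⁻¹))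
    MeasurableSet.univ univ_mem (measure_ne_top _ _) ?_ ?_ ?_ ?_ hf.integrable_area
    hf.continuousAt
  · have h2 := h.const_mul (area.real Set.univ)
    refine h2.congr fun s => ?_
    rw [← integral_const_mul]
    refine integral_congr_ae (Eventually.of_forall fun x => ?_)
    simp only [smul_eq_mul]
    field_simp
  · filter_upwards [self_mem_nhdsWithin] with s hs x
    have hs : 1 < s := hs
    have : 0 ≤ s ^ 2 - 1 := by nlinarith
    positivity
  · intro u hu hpu
    obtain ⟨r, hr, hru⟩ := Metric.isOpen_iff.1 hu p hpu
    rw [Metric.tendstoUniformlyOn_iff]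
    intro ε hε
    have hlim : Tendsto (fun s : ℝ => (area.real Set.univ)⁻¹ * ((s ^ 2 - 1) * ((r ^ 2 / 2) ^ 2)⁻¹))
        (𝓝[>] 1) (𝓝 0) := by
      have : Continuous fun s : ℝ =>
          (area.real Set.univ)⁻¹ * ((s ^ 2 - 1) * ((r ^ 2 / 2) ^ 2)⁻¹) := by fun_prop
      have := this.tendsto 1
      simp only [one_pow, sub_self, zero_mul, mul_zero] at this
      exact this.mono_left nhdsWithin_le_nhds
    filter_upwards [self_mem_nhdsWithin, hlim.eventually (gt_mem_nhds hε)] with s hs hlt x hx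
    have hs : 1 < s := hs
    have h0 : 0 ≤ s ^ 2 - 1 := by nlinarith
    have hd : r ≤ dist x p := by
      by_contra hlt
      exact hx (hru (Metric.mem_ball.2 (not_le.1 hlt)))
    have hd2 := dist_sq_eq p x
    have hcos : r ^ 2 / 2 ≤ s - cosDist p x := by
      have : r ^ 2 ≤ dist x p ^ 2 := by gcongr
      linarith
    rw [Pi.zero_apply, dist_zero_left, Real.norm_of_nonneg (by positivity)]
    refine lt_of_le_of_lt ?_ hlt
    gcongr
  · refine tendsto_const_nhds.congr' ?_
    filter_upwards [self_mem_nhdsWithin] with s hs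
    rw [setIntegral_univ, integral_const_mul, integral_kernel p hs, inv_mul_cancel₀ hm.ne']
  · filter_upwards [self_mem_nhdsWithin] with s hs
    exact ((smooth_kernel p hs (n := 0)).integrable.const_mul _).aestronglyMeasurable

open MeasureTheory in
/-- Square-integrability extracted from a lower Lebesgue integral. -/
lemma integral_sum_sq_le {k : ℕ} {T : TField k} (hT : Integrable T area) {δ : ℝ} (hδ : 0 < δ)
    (h : ∫⁻ x, ENNReal.ofReal (∑ I, T x I ^ 2) ∂area ≤ ENNReal.ofReal δ ^ 2) :
    Integrable (fun x => ∑ I, T x I ^ 2) area ∧ ∫ x, ∑ I, T x I ^ 2 ∂area ≤ δ ^ 2 := by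
  have hm : AEStronglyMeasurable (fun x => ∑ I, T x I ^ 2) area := by
    refine Finset.aestronglyMeasurable_fun_sum _ fun I _ => ?_
    exact ((continuous_apply I).comp_aestronglyMeasurable hT.aestronglyMeasurable).pow 2
  have h0 : ∀ x, 0 ≤ ∑ I, T x I ^ 2 := fun x => Finset.sum_nonneg fun I _ => sq_nonneg _
  rw [← ENNReal.ofReal_pow hδ.le] at h
  refine ⟨⟨hm, ?_⟩, ?_⟩
  · rw [hasFiniteIntegral_iff_ofReal (Filter.Eventually.of_forall h0)]
    exact h.trans_lt ENNReal.ofReal_lt_top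
  · rw [integral_eq_lintegral_of_nonneg_ae (Filter.Eventually.of_forall h0) hm]
    exact ENNReal.toReal_le_of_le_ofReal (by positivity) h

/-- Unfolding a bound on the Sobolev norm, for the first two weak derivatives. -/
lemma exists_weak_derivatives {m : ℕ} (hm : 2 ≤ m) {f : Scalar} {δ : ℝ}
    (h : sobolevNorm m (ofScalar f) < ENNReal.ofReal δ) :
    ∃ (S : TField 1) (T : TField 2), IsWeakCov (ofScalar f) S ∧ IsWeakCov S T ∧
      ∫⁻ x, ENNReal.ofReal (∑ I, ofScalar f x I ^ 2) ∂area ≤ ENNReal.ofReal δ ^ 2 ∧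
      ∫⁻ x, ENNReal.ofReal (∑ I, T x I ^ 2) ∂area ≤ ENNReal.ofReal δ ^ 2 := by
  unfold sobolevNorm at h
  simp only [iInf_lt_iff] at h
  obtain ⟨F, hF0, hF, hlt⟩ := h
  have hle : ∀ i ∈ Finset.range (m + 1),
      ∫⁻ x, ENNReal.ofReal (∑ I, F i x I ^ 2) ∂area ≤ ENNReal.ofReal δ ^ 2 := by
    intro i hi
    refine (Finset.single_le_sum (f := fun i => ∫⁻ x, ENNReal.ofReal (∑ I, F i x I ^ 2) ∂area)
      (fun _ _ => zero_le) hi).trans ?_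
    have := ENNReal.rpow_le_rpow hlt.le (zero_le_two (α := ℝ))
    rw [← ENNReal.rpow_mul] at this
    norm_num at this
    exact this
  refine ⟨F 1, F 2, hF0 ▸ hF 0 (by omega), hF 1 (by omega), ?_, hle 2 (by simp; omega)⟩
  rw [← hF0]
  exact hle 0 (by simp)

lemma sum_round_sq (x : S2) : ∑ I : Fin 2 → Fin 3, round x (I 0) (I 1) ^ 2 = 2 := by
  simp only [sum_fin_succ_fun, sum_fin_zero_fun]
  simp only [Fin.cons_zero, Fin.cons_one, pow_two]
  rw [← sum_round_diag x]
  refine Finset.sum_congr rfl fun i _ => ?_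
  rw [← sum_round_mul_round x i i]
  exact Finset.sum_congr rfl fun j _ => by rw [round_comm x j i]

open MeasureTheory in
/-- The pairing of a quantity of size `δ` in `L²` with a bounded one is of size `δ`. If `q G` is not
integrable its integral is `0`, and the bound holds all the same. -/
lemma abs_integral_mul_le {q G : Scalar}
    (hq2 : Integrable (fun x => q x ^ 2) area) (hG : Continuous G) {a b δ : ℝ} (hδ : 0 < δ)
    (ha : ∫ x, q x ^ 2 ∂area ≤ a * δ ^ 2) (hb : ∫ x, G x ^ 2 ∂area ≤ b) :
    |∫ x, q x * G x ∂area| ≤ (a + b) / 2 * δ := by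
  have hG2 : Integrable (fun x => G x ^ 2) area := (hG.pow 2).integrable_area
  have hint := (hq2.const_mul (1 / (2 * δ))).add (hG2.const_mul (δ / 2))
  -- The weights `1 / δ` and `δ` in Young's inequality balance the two squares.
  have hpt : ∀ x, |q x * G x| ≤ 1 / (2 * δ) * q x ^ 2 + δ / 2 * G x ^ 2 := by
    intro x
    have e : 1 / (2 * δ) * q x ^ 2 + δ / 2 * G x ^ 2 - |q x * G x| =
        (|q x| - δ * |G x|) ^ 2 / (2 * δ) := by
      rw [abs_mul, ← sq_abs (q x), ← sq_abs (G x)]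
      field_simp
      ring
    have : 0 ≤ (|q x| - δ * |G x|) ^ 2 / (2 * δ) := by positivity
    linarith
  calc |∫ x, q x * G x ∂area| ≤ ∫ x, |q x * G x| ∂area := abs_integral_le_integral_abs
    _ ≤ ∫ x, (1 / (2 * δ) * q x ^ 2 + δ / 2 * G x ^ 2) ∂area := by
        refine integral_mono_of_nonneg (Filter.Eventually.of_forall fun x => abs_nonneg _) hint
          (Filter.Eventually.of_forall hpt)
    _ = 1 / (2 * δ) * ∫ x, q x ^ 2 ∂area + δ / 2 * ∫ x, G x ^ 2 ∂area := by
        rw [integral_add (hq2.const_mul _) (hG2.const_mul _), integral_const_mul,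
          integral_const_mul]
    _ ≤ 1 / (2 * δ) * (a * δ ^ 2) + δ / 2 * b := by gcongr
    _ = (a + b) / 2 * δ := by field_simp

open MeasureTheory Filter Topology in
/-- **Sobolev inequality** on the sphere: the weak Laplacian is paired with a family of smooth
approximations of the logarithmic Green's function, which is bounded in `L²`. -/
theorem exists_sup_le_sobolevNorm :
    ∃ C : ℝ, 0 < C ∧ ∀ (m : ℕ) (f : Scalar) (δ : ℝ), 2 ≤ m → Continuous f → 0 < δ →
      sobolevNorm m (ofScalar f) < ENNReal.ofReal δ → ∀ x, |f x| ≤ C * δ := by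
  set M := area.real Set.univ with hM
  have hMpos : 0 < M := area_real_univ_pos
  -- The first summand bounds the pairing with the logarithm, the second one the mean of `f`.
  refine ⟨((2 + 48 * M) / 2 + (1 + M) / 2) / M, by positivity, ?_⟩
  intro m f δ hm hf hδ hnorm p
  obtain ⟨S, T, hS, hT, hf2, hT2⟩ := exists_weak_derivatives hm hnorm
  obtain ⟨-, hf2le⟩ := integral_sum_sq_le hS.1 hδ hf2
  obtain ⟨hT2int, hT2le⟩ := integral_sum_sq_le hT.2.1 hδ hT2
  -- The weak Laplacian, as the trace of the second weak derivative.
  set q : Scalar := fun x => ∑ I, T x I * round x (I 0) (I 1)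
  have hqm : AEStronglyMeasurable q area := by
    refine Finset.aestronglyMeasurable_fun_sum _ fun I _ => ?_
    exact ((continuous_apply I).comp_aestronglyMeasurable hT.2.1.aestronglyMeasurable).mul
      (SmoothS.round (n := 0) _ _).continuous.aestronglyMeasurable
  have hqle : ∀ x, q x ^ 2 ≤ 2 * ∑ I, T x I ^ 2 := by
    intro x
    have := Finset.sum_mul_sq_le_sq_mul_sq Finset.univ (fun I => T x I) fun I => round x (I 0) (I 1)
    rw [sum_round_sq] at this
    linarith
  have hq2 : Integrable (fun x => q x ^ 2) area := by
    refine (hT2int.const_mul 2).mono' (hqm.pow 2) (Eventually.of_forall fun x => ?_)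
    rw [Real.norm_of_nonneg (sq_nonneg _)]
    exact hqle x
  have hq2le : ∫ x, q x ^ 2 ∂area ≤ 2 * δ ^ 2 := by
    refine (integral_mono hq2 (hT2int.const_mul 2) hqle).trans ?_
    rw [integral_const_mul]
    gcongr
  have hmean : |∫ x, f x ∂area| ≤ (1 + M) / 2 * δ := by
    have h1 : ∫ x, f x ^ 2 ∂area ≤ 1 * δ ^ 2 := by
      simp only [sum_fin_zero_fun] at hf2le
      simpa [ofScalar] using hf2le
    have := abs_integral_mul_le (G := fun _ => 1)
      (hf.pow 2).integrable_area continuous_const hδ h1 (b := M) (by simp [hM])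
    simpa using this
  have hbound : ∀ s : ℝ, 1 < s → s ≤ 2 →
      |∫ x, (s ^ 2 - 1) * ((s - cosDist p x) ^ 2)⁻¹ * f x ∂area| ≤
        ((2 + 48 * M) / 2 + (1 + M) / 2) * δ := by
    intro s hs hs2
    have h1 := integral_mul_laplacian hS hT (smooth_log_sub_cosDist p hs)
    have h2 := abs_integral_mul_le hq2
      (smooth_log_sub_cosDist p hs (n := 0)).continuous hδ hq2le (integral_log_sq_le p hs hs2)
    rw [← h1] at h2
    have h3 : ∫ x, f x * ∑ i, pd i (pd i fun x => Real.log (s - cosDist p x)) x ∂area =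
        (∫ x, (s ^ 2 - 1) * ((s - cosDist p x) ^ 2)⁻¹ * f x ∂area) - ∫ x, f x ∂area := by
      have hi : Integrable (fun x => (s ^ 2 - 1) * ((s - cosDist p x) ^ 2)⁻¹ * f x) area :=
        ((smooth_kernel p hs (n := 0)).continuous.mul hf).integrable_area
      rw [← integral_sub hi hf.integrable_area]
      refine integral_congr_ae (Eventually.of_forall fun x => ?_)
      simp only [laplacian_log p hs]
      ring
    rw [h3] at h2
    rw [abs_le] at *
    constructor <;> nlinarith [h2.1, h2.2, hmean.1, hmean.2]
  have hlim := (tendsto_integral_kernel p hf).abs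
  have hle := le_of_tendsto hlim (b := ((2 + 48 * M) / 2 + (1 + M) / 2) * δ) (by
    filter_upwards [Ioc_mem_nhdsGT (show (1 : ℝ) < 2 by norm_num)] with s hs
    exact hbound s hs.1 hs.2)
  rw [abs_mul, abs_of_pos area_real_univ_pos, ← hM] at hle
  rw [div_mul_eq_mul_div, le_div_iff₀ hMpos]
  linarith

/-! ### Regularity of the differential operators -/

variable {m n : WithTop ℕ∞}

/-- The covariant derivative loses one derivative. -/
lemma SmoothS.cov {k : ℕ} {T : TField k} (hT : ∀ J, SmoothS n fun x => T x J) (hm : m + 1 ≤ n)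
    (I : Fin (k + 1) → Fin 3) : SmoothS m fun x => cov T x I :=
  SmoothS.sum _ fun J _ => (SmoothS.prod _ fun _ _ => SmoothS.round _ _).mul ((hT J).pd _ hm)

lemma SmoothS.dS {f : Scalar} (hf : SmoothS n f) (hm : m + 1 ≤ n) (i : Fin 3) :
    SmoothS m fun x => dS f x i :=
  SmoothS.cov (fun _ => hf) hm _

lemma SmoothS.nabla1 {V : Form} (hV : ∀ i, SmoothS n fun x => V x i) (hm : m + 1 ≤ n)
    (i j : Fin 3) : SmoothS m fun x => nabla1 V x i j :=
  SmoothS.cov (T := ofForm V) (fun J => hV (J 0)) hm _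

lemma SmoothS.nabla2 {h : Tensor2} (hh : ∀ i j, SmoothS n fun x => h x i j) (hm : m + 1 ≤ n)
    (i j k : Fin 3) : SmoothS m fun x => nabla2 h x i j k :=
  SmoothS.cov (T := ofTensor2 h) (fun J => hh (J 0) (J 1)) hm _

lemma SmoothS.divR {V : Form} (hV : ∀ i, SmoothS n fun x => V x i) (hm : m + 1 ≤ n) :
    SmoothS m (divR V) := SmoothS.sum _ fun i _ => SmoothS.nabla1 hV hm i i

lemma SmoothS.D2star {V : Form} (hV : ∀ i, SmoothS n fun x => V x i) (hm : m + 1 ≤ n)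
    (i j : Fin 3) : SmoothS m fun x => D2star V x i j :=
  (SmoothS.const _).mul (((SmoothS.nabla1 hV hm i j).add (SmoothS.nabla1 hV hm j i)).sub
    ((SmoothS.divR hV hm).mul (SmoothS.round i j)))

lemma SmoothS.hodge {V : Form} (hV : ∀ i, SmoothS n fun x => V x i) (i : Fin 3) :
    SmoothS n fun x => hodge V x i := by
  have h : ∀ j k : Fin 3, SmoothS n fun x => V x j * (x : E3) k - V x k * (x : E3) j :=
    fun j k => ((hV j).mul (SmoothS.coord k)).sub ((hV k).mul (SmoothS.coord j))
  fin_cases i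
  · simpa [NullGluing.hodge, cross_apply] using h 1 2
  · simpa [NullGluing.hodge, cross_apply] using h 2 0
  · simpa [NullGluing.hodge, cross_apply] using h 0 1

/-! ### Smoothness of the harmonics -/

lemma smooth_azimuthal (k : ℤ) : SmoothS n (azimuthal k) := by
  have hc : ContDiff ℝ n fun p : ℝ × ℝ => ((⟨p.1, p.2⟩ : ℂ) ^ k.natAbs) := by
    refine ContDiff.pow ?_ _
    exact Complex.equivRealProdCLM.symm.contDiff
  have hp : ContDiffOn ℝ n (fun y : E3 => ((radial y : E3) 0, (radial y : E3) 1)) {0}ᶜ :=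
    ContDiffOn.prodMk (SmoothS.coord 0) (SmoothS.coord 1)
  have hcp := hc.comp_contDiffOn hp
  unfold azimuthal
  split_ifs with h1 h2
  · exact SmoothS.const 1
  · exact (SmoothS.const _).mul (Complex.reCLM.contDiff.comp_contDiffOn hcp)
  · exact (SmoothS.const _).mul (Complex.imCLM.contDiff.comp_contDiffOn hcp)

lemma smooth_Y (l : ℕ) (k : ℤ) : SmoothS n (Y l k) := by
  refine ((SmoothS.const _).mul ?_).mul (smooth_azimuthal k)
  have := (Polynomial.contDiff_aeval (R := ℝ) (𝕜 := ℝ)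
    (Polynomial.derivative^[k.natAbs] (legendreP l)) n).comp_contDiffOn (SmoothS.coord 2)
  simp only [Function.comp_def, Polynomial.coe_aeval_eq_eval] at this
  exact this

lemma smooth_YE (l : ℕ) (k : ℤ) (i : Fin 3) : SmoothS n fun x => YE l k x i :=
  (SmoothS.const _).mul (SmoothS.dS (smooth_Y (n := n + 1) l k) le_rfl i)

lemma smooth_YH (l : ℕ) (k : ℤ) (i : Fin 3) : SmoothS n fun x => YH l k x i :=
  (SmoothS.const _).mul
    (SmoothS.hodge (fun i => SmoothS.dS (smooth_Y (n := n + 1) l k) le_rfl i) i)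

lemma smooth_Ypsi (l : ℕ) (k : ℤ) (i j : Fin 3) : SmoothS n fun x => Ypsi l k x i j :=
  (SmoothS.const _).mul (SmoothS.D2star (fun i => smooth_YE (n := n + 1) l k i) le_rfl i j)

lemma smooth_Yphi (l : ℕ) (k : ℤ) (i j : Fin 3) : SmoothS n fun x => Yphi l k x i j :=
  (SmoothS.const _).mul (SmoothS.D2star (fun i => smooth_YH (n := n + 1) l k i) le_rfl i j)

/-! ### Regularity of the geometry of a metric -/

lemma smooth_normalMat (i j : Fin 3) : SmoothS n fun x => normalMat x i j :=
  (SmoothS.coord i).mul (SmoothS.coord j)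

lemma SmoothS.det {A : S2 → Matrix (Fin 3) (Fin 3) ℝ} (hA : ∀ i j, SmoothS n fun x => A x i j) :
    SmoothS n fun x => (A x).det := by
  simp only [Matrix.det_apply']
  exact SmoothS.sum _ fun σ _ => (SmoothS.const _).mul (SmoothS.prod _ fun i _ => hA _ _)

lemma SmoothS.matrix_inv {A : S2 → Matrix (Fin 3) (Fin 3) ℝ}
    (hA : ∀ i j, SmoothS n fun x => A x i j) (h0 : ∀ x, (A x).det ≠ 0) (i j : Fin 3) :
    SmoothS n fun x => (A x)⁻¹ i j := by
  simp only [Matrix.inv_def, Matrix.smul_apply, Ring.inverse_eq_inv', smul_eq_mul,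
    Matrix.adjugate_apply]
  refine ((SmoothS.det hA).inv h0).mul (SmoothS.det fun a b => ?_)
  by_cases h : a = j
  · subst h
    simp only [Matrix.updateRow_self]
    exact SmoothS.const _
  · simp only [Matrix.updateRow_ne h]
    exact hA a b

/-- The metric, extended by the square of the normal covector, is positive definite. -/
lemma posDef_add_normalMat {g : Tensor2} (hg : IsMetric g) (ht : Tangential (ofTensor2 g))
    (x : S2) : (g x + normalMat x).PosDef := by
  have hN : ∀ i j, normalMat x i j = (x : E3) i * (x : E3) j := fun _ _ => rfl
  have hsym := (hg x).1
  have hgx : ∀ i, ∑ j, g x i j * (x : E3) j = 0 := by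
    intro i
    have := ht x 1 ![i, 0]
    simpa [ofTensor2, mul_comm] using this
  have hxx := S2.sum_sq x
  refine Matrix.PosDef.of_dotProduct_mulVec_pos ?_ ?_
  · rw [Matrix.IsHermitian, Matrix.conjTranspose_eq_transpose_of_trivial, Matrix.transpose_add,
      hsym.eq]
    congr 1
    ext i j
    simp [hN, mul_comm]
  · intro V hV
    set a := ∑ i, V i * (x : E3) i
    -- The vector is split into its normal part `a x` and its tangential part `W`.
    set W : Fin 3 → ℝ := fun i => V i - a * (x : E3) i
    have hW : ∑ i, W i * (x : E3) i = 0 := by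
      simp only [W, sub_mul, Finset.sum_sub_distrib, mul_assoc, ← Finset.mul_sum, hxx]
      simp [a]
    have hgx' : ∀ i, ∑ j, g x j i * (x : E3) j = 0 := by
      intro i
      rw [← hgx i]
      exact Finset.sum_congr rfl fun j _ => by rw [hsym.apply]
    have key : star V ⬝ᵥ (g x + normalMat x).mulVec V =
        ∑ i, ∑ j, g x i j * W i * W j + a ^ 2 := by
      have e1 : ∑ i, ∑ j, g x i j * W i * W j = ∑ i, ∑ j, g x i j * V i * V j := by
        have h0 := hgx 0
        have h1 := hgx 1
        have h2 := hgx 2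
        have h0' := hgx' 0
        have h1' := hgx' 1
        have h2' := hgx' 2
        simp only [W, Fin.sum_univ_three] at h0 h1 h2 h0' h1' h2' ⊢
        linear_combination (-a * V 0 + a ^ 2 * (x : E3) 0) * h0 +
          (-a * V 1 + a ^ 2 * (x : E3) 1) * h1 + (-a * V 2 + a ^ 2 * (x : E3) 2) * h2
          - a * V 0 * h0' - a * V 1 * h1' - a * V 2 * h2'
      rw [e1]
      simp only [a, dotProduct, Matrix.mulVec, Matrix.add_apply, hN, Fin.sum_univ_three,
        star_trivial]
      ring
    rw [key]
    by_cases hW0 : W = 0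
    · have ha : a ≠ 0 := by
        rintro ha
        apply hV
        funext i
        have := congrFun hW0 i
        simpa [W, ha] using this
      have : 0 < a ^ 2 := by positivity
      simpa [hW0] using this
    · have := (hg x).2 W hW hW0
      positivity

section metric
variable {g : Tensor2} (hg : IsMetric g) (ht : Tangential (ofTensor2 g))
  (hs : ∀ i j, SmoothS n fun x => g x i j)
include hg ht

lemma det_add_normalMat_pos (x : S2) : 0 < (g x + normalMat x).det :=
  (posDef_add_normalMat hg ht x).det_pos

lemma confFactor_pos (x : S2) : 0 < confFactor g x :=
  Real.rpow_pos_of_pos (det_add_normalMat_pos hg ht x) _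

include hs

lemma smooth_confFactor : SmoothS n (confFactor g) :=
  (SmoothS.det fun i j => (hs i j).add (smooth_normalMat i j)).rpow _
    fun x => (det_add_normalMat_pos hg ht x).ne'

lemma smooth_ginv (i j : Fin 3) : SmoothS n fun x => ginv g x i j :=
  (SmoothS.matrix_inv (fun i j => (hs i j).add (smooth_normalMat i j))
    (fun x => (det_add_normalMat_pos hg ht x).ne') i j).sub (smooth_normalMat i j)

lemma smooth_conn (hm : m + 1 ≤ n) (d a b : Fin 3) : SmoothS m fun x => conn g x d a b := by
  have hmn : m ≤ n := le_self_add.trans hm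
  exact (SmoothS.const _).mul (SmoothS.sum _ fun e _ =>
    ((smooth_ginv hg ht hs d e).of_le hmn).mul
      (((SmoothS.nabla2 hs hm a b e).add (SmoothS.nabla2 hs hm b a e)).sub
        (SmoothS.nabla2 hs hm e a b)))

lemma smooth_gnabla1 {V : Form} (hV : ∀ i, SmoothS n fun x => V x i) (hm : m + 1 ≤ n)
    (a b : Fin 3) : SmoothS m fun x => gnabla1 g V x a b := by
  have hmn : m ≤ n := le_self_add.trans hm
  exact (SmoothS.nabla1 hV hm a b).sub (SmoothS.sum _ fun d _ =>
    (smooth_conn hg ht hs hm d a b).mul ((hV d).of_le hmn))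

lemma smooth_gnabla2 {h : Tensor2} (hh : ∀ i j, SmoothS n fun x => h x i j) (hm : m + 1 ≤ n)
    (c a b : Fin 3) : SmoothS m fun x => gnabla2 g h x c a b := by
  have hmn : m ≤ n := le_self_add.trans hm
  exact ((SmoothS.nabla2 hh hm c a b).sub (SmoothS.sum _ fun d _ =>
    (smooth_conn hg ht hs hm d c a).mul ((hh d b).of_le hmn))).sub (SmoothS.sum _ fun d _ =>
    (smooth_conn hg ht hs hm d c b).mul ((hh a d).of_le hmn))

lemma smooth_gdiv1 {V : Form} (hV : ∀ i, SmoothS n fun x => V x i) (hm : m + 1 ≤ n) :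
    SmoothS m (gdiv1 g V) :=
  SmoothS.sum _ fun a _ => SmoothS.sum _ fun b _ =>
    ((smooth_ginv hg ht hs a b).of_le (le_self_add.trans hm)).mul
      (smooth_gnabla1 hg ht hs hV hm a b)

lemma smooth_gdiv2 {h : Tensor2} (hh : ∀ i j, SmoothS n fun x => h x i j) (hm : m + 1 ≤ n)
    (a : Fin 3) : SmoothS m fun x => gdiv2 g h x a :=
  SmoothS.sum _ fun b _ => SmoothS.sum _ fun c _ =>
    ((smooth_ginv hg ht hs b c).of_le (le_self_add.trans hm)).mul
      (smooth_gnabla2 hg ht hs hh hm c b a)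

lemma smooth_gNablaHat {V : Form} (hV : ∀ i, SmoothS n fun x => V x i) (hm : m + 1 ≤ n)
    (a b : Fin 3) : SmoothS m fun x => gNablaHat g V x a b :=
  ((smooth_gnabla1 hg ht hs hV hm a b).add (smooth_gnabla1 hg ht hs hV hm b a)).sub
    ((smooth_gdiv1 hg ht hs hV hm).mul ((hs a b).of_le (le_self_add.trans hm)))

lemma smooth_gInner {h k : Tensor2} (hh : ∀ i j, SmoothS n fun x => h x i j)
    (hk : ∀ i j, SmoothS n fun x => k x i j) : SmoothS n (gInner g h k) :=
  SmoothS.sum _ fun a _ => SmoothS.sum _ fun b _ => SmoothS.sum _ fun c _ => SmoothS.sum _ fun d _ =>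
    (((smooth_ginv hg ht hs a c).mul (smooth_ginv hg ht hs b d)).mul (hh a b)).mul (hk c d)

lemma smooth_gContract {h : Tensor2} {V : Form} (hh : ∀ i j, SmoothS n fun x => h x i j)
    (hV : ∀ i, SmoothS n fun x => V x i) (a : Fin 3) : SmoothS n fun x => gContract g h V x a :=
  SmoothS.sum _ fun b _ => SmoothS.sum _ fun c _ =>
    ((hh a b).mul (smooth_ginv hg ht hs b c)).mul (hV c)

lemma smooth_gaussCurvature (hm : m + 2 ≤ n) : SmoothS m (gaussCurvature g) := by
  have hmn : m ≤ n := le_self_add.trans hm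
  have h1 : (m + 1) + 1 ≤ n := by rwa [add_assoc, one_add_one_eq_two]
  have hc := smooth_conn hg ht hs h1
  have hc0 : ∀ d a b, SmoothS m fun x => conn g x d a b := fun d a b =>
    (hc d a b).of_le le_self_add
  have hric : ∀ b d, SmoothS m fun x => ricci g x b d := by
    intro b d
    refine (((SmoothS.round b d).add (SmoothS.sum _ fun a _ => ?_)).sub ?_).add
      (SmoothS.sum _ fun a _ => SmoothS.sum _ fun e _ =>
        ((hc0 a a e).mul (hc0 e d b)).sub ((hc0 a d e).mul (hc0 e a b)))
    · exact SmoothS.cov (T := fun y I => conn g y (I 0) (I 1) (I 2)) (fun J => hc _ _ _) le_rfl _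
    · exact SmoothS.nabla1 (V := fun y c => ∑ a, conn g y a a c)
        (fun c => SmoothS.sum _ fun a _ => hc a a c) le_rfl d b
  exact (SmoothS.const _).mul (SmoothS.sum _ fun b _ => SmoothS.sum _ fun d _ =>
    ((smooth_ginv hg ht hs b d).of_le hmn).mul (hric b d))

end metric

/-! ### Coefficients with a weight of fixed sign -/

open MeasureTheory in
/-- Two densities `D` and `D'` that differ by `w U`, where the weight `w` has a fixed sign, and that
have the same coefficients with respect to finitely many fields `e k`. If `V` is in the span of these
fields and is a pointwise orthogonal projection of `U`, then `∫ w |V|² = ∫ w U · V = 0`, and `V`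
vanishes. -/
lemma eq_zero_of_weighted_coeff_eq {ι κ : Type*} [Fintype ι] (K : Finset κ)
    (e : κ → S2 → ι → ℝ) (he : ∀ k i, Continuous fun x => e k x i) (a : κ → ℝ)
    {w : Scalar} {c : ℝ} (hpos : ∀ x, 0 < c * w x) (hw : Continuous w)
    {D D' U V : S2 → ι → ℝ} (hD : ∀ i, Continuous fun x => D x i)
    (hD' : ∀ i, Continuous fun x => D' x i)
    (hdiff : ∀ x i, D x i - D' x i = w x * U x i)
    (hUV : ∀ x, ∑ i, U x i * V x i = ∑ i, V x i ^ 2)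
    (hV : ∀ x i, V x i = ∑ k ∈ K, a k * e k x i)
    (hcoeff : ∀ k ∈ K, ∫ x, ∑ i, D x i * e k x i ∂area = ∫ x, ∑ i, D' x i * e k x i ∂area) :
    ∀ x i, V x i = 0 := by
  have hVc : ∀ i, Continuous fun x => V x i := by
    intro i
    simp only [hV]
    exact continuous_finsetSum _ fun k _ => continuous_const.mul (he k i)
  have hint : ∀ {F : S2 → ι → ℝ}, (∀ i, Continuous fun x => F x i) → ∀ k,
      Integrable (fun x => ∑ i, F x i * e k x i) area := fun hF k =>
    (continuous_finsetSum _ fun i _ => (hF i).mul (he k i)).integrable_area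
  have horth : ∀ k ∈ K, ∫ x, ∑ i, (w x * U x i) * e k x i ∂area = 0 := by
    intro k hk
    have h := sub_eq_zero.2 (hcoeff k hk)
    rw [← integral_sub (hint hD k) (hint hD' k)] at h
    rw [← h]
    refine integral_congr_ae (Filter.Eventually.of_forall fun x => ?_)
    simp only [← hdiff, sub_mul, Finset.sum_sub_distrib]
  have hUc : ∀ i, Continuous fun x => w x * U x i := by
    intro i
    simp only [← hdiff]
    exact (hD i).sub (hD' i)
  have htot : ∫ x, w x * ∑ i, V x i ^ 2 ∂area = 0 := by
    have e1 : ∀ x, w x * ∑ i, V x i ^ 2 = ∑ k ∈ K, a k * ∑ i, (w x * U x i) * e k x i := by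
      intro x
      rw [← hUV x]
      conv_lhs => enter [2, 2, i]; rw [hV x i]
      simp only [Finset.mul_sum]
      rw [Finset.sum_comm]
      exact Finset.sum_congr rfl fun k _ => Finset.sum_congr rfl fun i _ => by ring
    simp only [e1]
    rw [integral_finsetSum _ fun k _ => (hint hUc k).const_mul _]
    refine Finset.sum_eq_zero fun k hk => ?_
    rw [integral_const_mul, horth k hk, mul_zero]
  have hcont : Continuous fun x => c * (w x * ∑ i, V x i ^ 2) :=
    continuous_const.mul (hw.mul (continuous_finsetSum _ fun i _ => (hVc i).pow 2))
  have hsq : ∀ x, 0 ≤ ∑ i, V x i ^ 2 := fun x => Finset.sum_nonneg fun i _ => sq_nonneg _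
  have hnn : ∀ x, 0 ≤ c * (w x * ∑ i, V x i ^ 2) := by
    intro x
    rw [← mul_assoc]
    exact mul_nonneg (hpos x).le (hsq x)
  have hz : ∫ x, c * (w x * ∑ i, V x i ^ 2) ∂area = 0 := by
    rw [integral_const_mul, htot, mul_zero]
  rw [integral_eq_zero_iff_of_nonneg hnn hcont.integrable_area] at hz
  have hz' := (hcont.ae_eq_iff_eq area continuous_zero).1 hz
  intro x i
  have h := congrFun hz' x
  simp only [Pi.zero_apply, ← mul_assoc] at h
  have h2 := (mul_eq_zero.1 h).resolve_left (hpos x).ne'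
  rw [Finset.sum_eq_zero_iff_of_nonneg fun i _ => sq_nonneg _] at h2
  exact pow_eq_zero_iff two_ne_zero |>.1 (h2 i (Finset.mem_univ i))

/-! ### Regularity of the charge densities -/

lemma smooth_of_inH_scalar {k : ℕ} {f : Scalar} (h : InH k (ofScalar f)) :
    SmoothS ((k - 2 : ℕ) : WithTop ℕ∞) f := contDiffOn_pi.1 h.2.1 ![]

lemma smooth_of_inH_form {k : ℕ} {V : Form} (h : InH k (ofForm V)) (i : Fin 3) :
    SmoothS ((k - 2 : ℕ) : WithTop ℕ∞) fun x => V x i := contDiffOn_pi.1 h.2.1 ![i]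

lemma smooth_of_inH_tensor {k : ℕ} {T : Tensor2} (h : InH k (ofTensor2 T)) (i j : Fin 3) :
    SmoothS ((k - 2 : ℕ) : WithTop ℕ∞) fun x => T x i j := contDiffOn_pi.1 h.2.1 ![i, j]

section regularity
variable {X : C2Data} (hX : IsC2SphereData 8 X)
include hX

lemma smooth_Om : SmoothS 4 X.Om := (smooth_of_inH_scalar hX.Om_mem).of_le (by norm_num)

lemma smooth_g (i j : Fin 3) : SmoothS 4 fun x => X.g x i j :=
  (smooth_of_inH_tensor hX.g_mem i j).of_le (by norm_num)

lemma smooth_phi : SmoothS 4 (confFactor X.g) :=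
  smooth_confFactor hX.g_metric hX.g_mem.1 (smooth_g hX)

lemma smooth_trChi : SmoothS 4 (trChi X) :=
  ((smooth_of_inH_scalar hX.OmTrChi_mem).of_le (by norm_num)).div (smooth_Om hX)
    fun x => (hX.Om_pos x).ne'

lemma smooth_trChib : SmoothS 4 (trChib X) :=
  ((smooth_of_inH_scalar hX.OmTrChib_mem).of_le (by norm_num)).div (smooth_Om hX)
    fun x => (hX.Om_pos x).ne'

lemma smooth_zeta (i : Fin 3) : SmoothS 3 fun x => zeta X x i :=
  ((smooth_of_inH_form hX.eta_mem i).of_le (by norm_num)).sub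
    (SmoothS.dS ((smooth_Om hX).log fun x => (hX.Om_pos x).ne') (by norm_num) i)

lemma smooth_chih (i j : Fin 3) : SmoothS 4 fun x => X.chih x i j :=
  (smooth_of_inH_tensor hX.chih_mem i j).of_le (by norm_num)

lemma smooth_beta (i : Fin 3) : SmoothS 3 fun x => beta X x i := by
  have h34 : (3 : WithTop ℕ∞) ≤ 4 := by norm_num
  have h1 := smooth_gdiv2 hX.g_metric hX.g_mem.1 (smooth_g hX) (smooth_chih hX) (m := 3)
    (by norm_num) i
  have h2 := (SmoothS.const (1 / 2)).mul (SmoothS.dS (smooth_trChi hX) (m := 3) (by norm_num) i)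
  have h3 := smooth_gContract hX.g_metric hX.g_mem.1
    (fun i j => (smooth_g hX i j).of_le h34) (fun i j => (smooth_chih hX i j).of_le h34)
    (smooth_zeta hX) i
  have h4 := ((SmoothS.const (1 / 2)).mul ((smooth_trChi hX).of_le h34)).mul (smooth_zeta hX i)
  exact (((h1.sub h2).add h3).sub h4).neg

lemma smooth_energyDensity : SmoothS 2 (energyDensity X) := by
  have h24 : (2 : WithTop ℕ∞) ≤ 4 := by norm_num
  have hphi := (smooth_phi hX).of_le h24
  have hK := smooth_gaussCurvature hX.g_metric hX.g_mem.1 (smooth_g hX) (m := 2) (by norm_num)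
  have hchi := smooth_gInner hX.g_metric hX.g_mem.1 (smooth_g hX) (smooth_chih hX)
    (k := X.chibh) fun i j => (smooth_of_inH_tensor hX.chibh_mem i j).of_le (by norm_num)
  have hrho : SmoothS 2 (rho X) :=
    ((hK.add (((SmoothS.const (1 / 4)).mul ((smooth_trChi hX).of_le h24)).mul
      ((smooth_trChib hX).of_le h24))).sub ((SmoothS.const (1 / 2)).mul (hchi.of_le h24))).neg
  exact (hphi.pow 3).mul (hrho.add (hphi.mul (smooth_gdiv1 hX.g_metric hX.g_mem.1
    (fun i j => (smooth_g hX i j).of_le (by norm_num)) (smooth_beta hX) (by norm_num))))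

lemma smooth_momentumDensity (i : Fin 3) : SmoothS 3 fun x => momentumDensity X x i :=
  (((smooth_phi hX).of_le (by norm_num)).pow 3).mul
    ((SmoothS.dS (smooth_trChi hX) (by norm_num) i).add
      (((smooth_trChi hX).of_le (by norm_num)).mul (smooth_zeta hX i)))

end regularity

lemma smooth_thirdOrderDensity {X : C3Data} (hX : IsC3SphereData X) (i j : Fin 3) :
    SmoothS 0 fun x => thirdOrderDensity X x i j := by
  have hphi := (smooth_phi hX.c2).of_le (m := 0) (by norm_num)
  have h0 : ∀ x, confFactor X.toC2.g x ≠ 0 := fun x =>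
    (confFactor_pos hX.c2.g_metric hX.c2.g_mem.1 x).ne'
  have hg := smooth_g hX.c2
  have halb : ∀ i j, SmoothS 2 fun x => X.toC2.alb x i j := fun i j =>
    (smooth_of_inH_tensor hX.c2.alb_mem i j).of_le (by norm_num)
  have hdiv := smooth_gdiv2 hX.c2.g_metric hX.c2.g_mem.1
    (fun i j => (hg i j).of_le (by norm_num)) halb (m := 1) (by norm_num)
  have hhat := smooth_gNablaHat hX.c2.g_metric hX.c2.g_mem.1
    (fun i j => (hg i j).of_le (by norm_num)) hdiv (m := 0) (by norm_num)
  exact (((SmoothS.const 1).div hphi h0).mul ((smooth_of_inH_tensor hX.Dbalb_mem i j).of_le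
    (by norm_num))).add (((SmoothS.const 1).div (hphi.pow 2) fun x => pow_ne_zero _ (h0 x)).mul
    (((halb i j).of_le (by norm_num)).add ((hphi.pow 2).mul (hhat i j))))

/-! ### Recovering the data -/

lemma metric_eq_of_confFactor_eq {g g' : Tensor2} (hpos : ∀ x, 0 < confFactor g x)
    (h1 : confFactor g = confFactor g') (h2 : confClass g = confClass g') : g = g' := by
  funext x
  have h := congrFun h2 x
  have hp : (confFactor g x ^ 2)⁻¹ ≠ 0 := inv_ne_zero (pow_ne_zero _ (hpos x).ne')
  simp only [confClass, ← h1] at h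
  exact smul_right_injective _ hp h

/-- The modes `l = 1` of `η` are recovered from the charges `L` and `G`: the weight `φ³ tr χ` has
the sign of `tr χ`. -/
lemma eta_eq_of_momentum {X X' : C2Data} (hX : IsC2SphereData 8 X) (hX' : IsC2SphereData 8 X')
    (hOm : X.Om = X'.Om) (hg : X.g = X'.g) (hT : X.OmTrChi = X'.OmTrChi)
    (hGE : formModesGE 2 X.eta = formModesGE 2 X'.eta) {c : ℝ} (hc : ∀ x, 0 < c * X.OmTrChi x)
    (hE : ∀ k ∈ Finset.Icc (-1 : ℤ) 1,
      coeffE (momentumDensity X) 1 k = coeffE (momentumDensity X') 1 k)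
    (hH : ∀ k ∈ Finset.Icc (-1 : ℤ) 1,
      coeffH (momentumDensity X) 1 k = coeffH (momentumDensity X') 1 k) : X.eta = X'.eta := by
  have htr : trChi X = trChi X' := by unfold trChi; rw [hOm, hT]
  have hphi := confFactor_pos hX.g_metric hX.g_mem.1
  have key := eq_zero_of_weighted_coeff_eq
    ((Finset.Icc (-1 : ℤ) 1).disjSum (Finset.Icc (-1 : ℤ) 1))
    (Sum.elim (fun k => YE 1 k) fun k => YH 1 k)
    (by
      rintro (k | k) i
      · exact (smooth_YE (n := 0) 1 k i).continuous
      · exact (smooth_YH (n := 0) 1 k i).continuous)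
    (Sum.elim (fun k => coeffE X.eta 1 k - coeffE X'.eta 1 k)
      fun k => coeffH X.eta 1 k - coeffH X'.eta 1 k)
    (w := fun x => confFactor X.g x ^ 3 * trChi X x) (c := c)
    (D := momentumDensity X) (D' := momentumDensity X')
    (U := fun x i => X.eta x i - X'.eta x i) (V := fun x i => X.eta x i - X'.eta x i)
    ?_ (((smooth_phi hX).pow 3).mul (smooth_trChi hX)).continuous
    (fun i => (smooth_momentumDensity hX i).continuous)
    (fun i => (smooth_momentumDensity hX' i).continuous) ?_ ?_ ?_ ?_
  · funext x i
    exact sub_eq_zero.1 (key x i)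
  · intro x
    have h1 := hX.Om_pos x
    have h2 := hphi x
    have h3 := hc x
    have : c * (confFactor X.g x ^ 3 * trChi X x) =
        confFactor X.g x ^ 3 * (c * X.OmTrChi x) / X.Om x := by
      simp only [trChi]; ring
    rw [this]
    positivity
  · intro x i
    simp only [momentumDensity, zeta, ← htr, ← hg, ← hOm, Pi.smul_apply, Pi.add_apply,
      Pi.sub_apply, smul_eq_mul]
    ring
  · exact fun x => Finset.sum_congr rfl fun i _ => by ring
  · intro x i
    have h := congrFun (congrFun hGE x) i
    have hI : Finset.Ico 1 2 = {1} := rfl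
    simp only [formModesGE, formModesLT, hI, Finset.sum_singleton, Pi.sub_apply, Finset.sum_apply,
      Pi.add_apply, Pi.smul_apply, smul_eq_mul, Finset.sum_add_distrib, Nat.cast_one] at h
    simp only [Finset.sum_disjSum, Sum.elim_inl, Sum.elim_inr, sub_mul, Finset.sum_sub_distrib]
    linarith
  · intro k hk
    rcases Finset.mem_disjSum.1 hk with ⟨k, hk', rfl⟩ | ⟨k, hk', rfl⟩
    · exact hE k hk'
    · exact hH k hk'

/-- The modes `l ≤ 1` of `Ω tr χ-bar` are recovered from the charges `E` and `P`: it enters the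
energy density through the Gauss equation only, with the weight `-φ³ tr χ / (4 Ω)`. -/
lemma OmTrChib_eq_of_energy {X X' : C2Data} (hX : IsC2SphereData 8 X) (hX' : IsC2SphereData 8 X')
    (hOm : X.Om = X'.Om) (hg : X.g = X'.g) (hT : X.OmTrChi = X'.OmTrChi)
    (hchih : X.chih = X'.chih) (hchibh : X.chibh = X'.chibh) (heta : X.eta = X'.eta)
    (hGE : modesGE 2 X.OmTrChib = modesGE 2 X'.OmTrChib) {c : ℝ}
    (hc : ∀ x, 0 < c * X.OmTrChi x)
    (hE : coeff (energyDensity X) 0 0 = coeff (energyDensity X') 0 0)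
    (hP : ∀ k ∈ Finset.Icc (-1 : ℤ) 1,
      coeff (energyDensity X) 1 k = coeff (energyDensity X') 1 k) : X.OmTrChib = X'.OmTrChib := by
  have htr : trChi X = trChi X' := by unfold trChi; rw [hOm, hT]
  have hzeta : zeta X = zeta X' := by unfold zeta; rw [hOm, heta]
  have hbeta : beta X = beta X' := by unfold beta; rw [hg, hchih, htr, hzeta]
  have hphi := confFactor_pos hX.g_metric hX.g_mem.1
  have key := eq_zero_of_weighted_coeff_eq (ι := Unit)
    ((Finset.range 2).sigma fun l => Finset.Icc (-(l : ℤ)) l)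
    (fun p x _ => Y p.1 p.2 x)
    (fun p _ => (smooth_Y (n := 0) p.1 p.2).continuous)
    (fun p => coeff X.OmTrChib p.1 p.2 - coeff X'.OmTrChib p.1 p.2)
    (w := fun x => -1 / 4 * (confFactor X.g x ^ 3 * trChi X x / X.Om x)) (c := -c)
    (D := fun x _ => energyDensity X x) (D' := fun x _ => energyDensity X' x)
    (U := fun x _ => X.OmTrChib x - X'.OmTrChib x)
    (V := fun x _ => X.OmTrChib x - X'.OmTrChib x)
    ?_ ((SmoothS.const _).mul ((((smooth_phi hX).pow 3).mul (smooth_trChi hX)).div (smooth_Om hX)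
      fun x => (hX.Om_pos x).ne')).continuous
    (fun _ => (smooth_energyDensity hX).continuous)
    (fun _ => (smooth_energyDensity hX').continuous) ?_ ?_ ?_ ?_
  · funext x
    exact sub_eq_zero.1 (key x ())
  · intro x
    have h1 := hX.Om_pos x
    have h2 := hphi x
    have h3 := hc x
    have : -c * (-1 / 4 * (confFactor X.g x ^ 3 * trChi X x / X.Om x)) =
        1 / 4 * (confFactor X.g x ^ 3 * (c * X.OmTrChi x) / X.Om x / X.Om x) := by
      simp only [trChi]; ring
    rw [this]
    positivity
  · intro x _
    simp only [energyDensity, rho, trChib, ← htr, ← hbeta, ← hg, ← hchih, ← hchibh, ← hOm]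
    ring
  · exact fun x => Finset.sum_congr rfl fun i _ => by ring
  · intro x _
    have h := congrFun hGE x
    simp only [modesGE, modesLT] at h
    simp only [Finset.sum_sigma, sub_mul, Finset.sum_sub_distrib]
    linarith
  · rintro ⟨l, k⟩ hk
    simp only [Finset.mem_sigma, Finset.mem_range] at hk
    simp only [Finset.univ_unique, Finset.sum_singleton]
    obtain ⟨hl, hk⟩ := hk
    interval_cases l
    · obtain rfl : k = 0 := by simpa using hk
      exact hE
    · exact hP k (by simpa using hk)

/-- The trace of the round metric with respect to `g` is positive. -/
lemma sum_ginv_mul_round_pos {g : Tensor2} (hg : IsMetric g) (ht : Tangential (ofTensor2 g))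
    (x : S2) : 0 < ∑ i, ∑ j, ginv g x i j * round x i j := by
  set B := (g x + normalMat x)⁻¹
  have hB : B.PosDef := (posDef_add_normalMat hg ht x).inv
  have h1 : ∑ i, ∑ j, ginv g x i j * round x i j =
      ∑ k, star (fun i => round x i k) ⬝ᵥ
        B.mulVec fun i => round x i k := by
    -- The round metric is a projection, so that the trace is a sum of values of the quadratic
    -- form `B` on its columns.
    have e1 : ∀ i j, ginv g x i j * round x i j =
        ∑ k, B i j * (round x i k * round x k j)
          - (x : E3) i * ((x : E3) j * round x j i) := by
      intro i j
      rw [← Finset.mul_sum, sum_round_mul_round, round_comm x j i]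
      simp only [ginv, normalMat, Matrix.sub_apply, Matrix.of_apply, B]
      ring
    simp only [e1, Finset.sum_sub_distrib, ← Finset.mul_sum, sum_coord_mul_round, mul_zero,
      sub_zero]
    simp only [dotProduct, Matrix.mulVec, star_trivial, Finset.mul_sum]
    simp only [Fin.sum_univ_three, round_comm x 1 0, round_comm x 2 0, round_comm x 2 1]
    ring
  rw [h1]
  refine Finset.sum_pos' (fun k _ => hB.posSemidef.dotProduct_mulVec_nonneg _) ?_
  by_contra hne
  push Not at hne
  have h2 : ∀ k, round x k k = 0 := by
    intro k
    by_contra hk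
    have := hB.dotProduct_mulVec_pos (x := fun i => round x i k)
      (fun h => hk (congrFun h k))
    exact absurd this (not_lt.2 (hne k (Finset.mem_univ k)))
  have := sum_round_diag x
  simp [h2] at this

/-- The modes `l = 2` of `D-bar-hat α-bar` are recovered from the charges `U` and `V`; what is left
is a multiple of the round metric, which vanishes since it is trace-free with respect to `g`. -/
lemma Dbalb_eq_of_thirdOrder {X X' : C3Data} (hX : IsC3SphereData X) (hX' : IsC3SphereData X')
    (hg : X.toC2.g = X'.toC2.g) (halb : X.toC2.alb = X'.toC2.alb)
    (hGE : tensorModesGE 3 X.Dbalb = tensorModesGE 3 X'.Dbalb)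
    (hU : ∀ k ∈ Finset.Icc (-2 : ℤ) 2,
      coeffPsi (thirdOrderDensity X) 2 k = coeffPsi (thirdOrderDensity X') 2 k)
    (hV : ∀ k ∈ Finset.Icc (-2 : ℤ) 2,
      coeffPhi (thirdOrderDensity X) 2 k = coeffPhi (thirdOrderDensity X') 2 k) :
    X.Dbalb = X'.Dbalb := by
  have hphi := confFactor_pos hX.c2.g_metric hX.c2.g_mem.1
  -- The difference `W`; the modes only see its trace-free part `W - (tr W / 2) γ`.
  set W : Tensor2 := fun x => X.Dbalb x - X'.Dbalb x with hW
  have hWt : ∀ (x : S2) i, ∑ j, (x : E3) j * W x i j = 0 := by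
    intro x i
    have h1 := hX.Dbalb_mem.1 x 1 ![i, 0]
    have h2 := hX'.Dbalb_mem.1 x 1 ![i, 0]
    simp only [ofTensor2] at h1 h2
    simp only [hW, Matrix.sub_apply, mul_sub, Finset.sum_sub_distrib]
    simpa using congrArg₂ (· - ·) h1 h2
  have hWr : ∀ x, ∑ i, ∑ j, W x i j * round x i j = (W x).trace := by
    intro x
    have e1 : ∀ i, ∑ j, W x i j * round x i j = W x i i := by
      intro i
      have h := hWt x i
      have e2 : ∀ j, W x i j * ((x : E3) i * (x : E3) j) = (x : E3) i * ((x : E3) j * W x i j) :=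
        fun j => by ring
      simp only [round_apply, mul_sub, Finset.sum_sub_distrib, e2, ← Finset.mul_sum, h]
      simp
    simp only [e1]
    rfl
  have hrr : ∀ x, ∑ i, ∑ j, round x i j * round x i j = 2 := by
    intro x
    rw [← sum_round_diag x]
    refine Finset.sum_congr rfl fun i _ => ?_
    rw [← sum_round_mul_round x i i]
    exact Finset.sum_congr rfl fun j _ => by rw [round_comm x j i]
  have hVW : ∀ x i j, tracefreeR X.Dbalb x i j - tracefreeR X'.Dbalb x i j =
      W x i j - (W x).trace / 2 * round x i j := by
    intro x i j
    simp only [tracefreeR, hW, Matrix.sub_apply, Matrix.smul_apply, smul_eq_mul, Matrix.trace_sub]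
    ring
  have key := eq_zero_of_weighted_coeff_eq (ι := Fin 3 × Fin 3)
    ((Finset.Icc (-2 : ℤ) 2).disjSum (Finset.Icc (-2 : ℤ) 2))
    (Sum.elim (fun k x p => Ypsi 2 k x p.1 p.2) fun k x p => Yphi 2 k x p.1 p.2)
    (by
      rintro (k | k) p
      · exact (smooth_Ypsi (n := 0) 2 k p.1 p.2).continuous
      · exact (smooth_Yphi (n := 0) 2 k p.1 p.2).continuous)
    (Sum.elim (fun k => coeffPsi X.Dbalb 2 k - coeffPsi X'.Dbalb 2 k)
      fun k => coeffPhi X.Dbalb 2 k - coeffPhi X'.Dbalb 2 k)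
    (w := fun x => (confFactor X.toC2.g x)⁻¹) (c := 1)
    (D := fun x p => thirdOrderDensity X x p.1 p.2)
    (D' := fun x p => thirdOrderDensity X' x p.1 p.2)
    (U := fun x p => W x p.1 p.2)
    (V := fun x p => tracefreeR X.Dbalb x p.1 p.2 - tracefreeR X'.Dbalb x p.1 p.2)
    (fun x => by have := hphi x; positivity)
    ((smooth_phi hX.c2).inv fun x => (hphi x).ne').continuous
    (fun p => (smooth_thirdOrderDensity hX p.1 p.2).continuous)
    (fun p => (smooth_thirdOrderDensity hX' p.1 p.2).continuous) ?_ ?_ ?_ ?_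
  · funext x
    have h0 : ∀ i j, W x i j = (W x).trace / 2 * round x i j := by
      intro i j
      have := key x (i, j)
      simp only [hVW] at this
      linarith
    have htf : ∑ i, ∑ j, ginv X.toC2.g x i j * W x i j = 0 := by
      have h1 := (hX.Dbalb_tf x).2
      have h2 := (hX'.Dbalb_tf x).2
      rw [← hg] at h2
      simp only [hW, Matrix.sub_apply, mul_sub, Finset.sum_sub_distrib, h1, h2, sub_zero]
    have htf2 : (W x).trace / 2 * ∑ i, ∑ j, ginv X.toC2.g x i j * round x i j = 0 := by
      rw [← htf]
      simp only [Finset.mul_sum]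
      refine Finset.sum_congr rfl fun i _ => Finset.sum_congr rfl fun j _ => ?_
      rw [h0 i j]
      ring
    have htr := (mul_eq_zero.1 htf2).resolve_right
      (sum_ginv_mul_round_pos hX.c2.g_metric hX.c2.g_mem.1 x).ne'
    ext i j
    have := h0 i j
    rw [htr, zero_mul] at this
    exact sub_eq_zero.1 this
  · intro x p
    simp only [thirdOrderDensity, ← hg, ← halb, hW, Matrix.add_apply, Matrix.smul_apply,
      Matrix.sub_apply, smul_eq_mul]
    ring
  · intro x
    simp only [hVW, Fintype.sum_prod_type]
    have h1 := hWr x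
    have h2 := hrr x
    have e : ∀ i j, W x i j * (W x i j - (W x).trace / 2 * round x i j) =
        (W x i j - (W x).trace / 2 * round x i j) ^ 2
        + (W x).trace / 2 * (W x i j * round x i j)
        - ((W x).trace / 2) ^ 2 * (round x i j * round x i j) :=
      fun i j => by ring
    simp only [e, Finset.sum_add_distrib, Finset.sum_sub_distrib, ← Finset.mul_sum, h1, h2]
    ring
  · intro x p
    have h := congrFun (congrFun (congrFun hGE x) p.1) p.2
    have hI : Finset.Ico 2 3 = {2} := rfl
    simp only [tensorModesGE, tensorModesLT, hI, Finset.sum_singleton, Matrix.sub_apply,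
      Matrix.sum_apply, Matrix.add_apply, Matrix.smul_apply, smul_eq_mul, Finset.sum_add_distrib,
      Nat.cast_ofNat] at h
    simp only [Finset.sum_disjSum, Sum.elim_inl, Sum.elim_inr, sub_mul, Finset.sum_sub_distrib]
    linarith
  · intro k hk
    simp only [Fintype.sum_prod_type]
    rcases Finset.mem_disjSum.1 hk with ⟨k, hk', rfl⟩ | ⟨k, hk', rfl⟩
    · exact hU k hk'
    · exact hV k hk'

/-- The modes removed by `modesGE` determine the function together with it. -/
lemma eq_of_modes_eq {L : ℕ} {f f' : Scalar} (h1 : modesGE L f = modesGE L f')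
    (h2 : modesLT L f = modesLT L f') : f = f' := by
  funext x
  have := congrFun h1 x
  simp only [modesGE, h2] at this
  linarith

/-! ### The sign of the null expansion and the low modes -/

lemma sobolevNorm_OmTrChi_le (X : C3Data) : sobolevNorm 8 (ofScalar X.toC2.OmTrChi) ≤ c3Norm X := by
  unfold c3Norm c2Norm
  iterate 14 refine le_add_right ?_
  exact le_add_self

/-- Data close to the reference data have an expansion `Ω tr χ` of the sign of `v`. -/
lemma exists_OmTrChi_sign {v : ℝ} (hv : v ≠ 0) : ∃ ε : ℝ, 0 < ε ∧ ∀ X : C3Data,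
    IsC3SphereData X → c3Norm (X - minkowski v) < ENNReal.ofReal ε →
      ∀ x, 0 < v * X.toC2.OmTrChi x := by
  obtain ⟨C, hC, hsob⟩ := exists_sup_le_sobolevNorm
  have hv' : 0 < |v| := abs_pos.2 hv
  -- This makes `|Ω tr χ - 2 / v| ≤ 1 / |v|`.
  refine ⟨1 / (|v| * C), by positivity, fun X hX hnorm x => ?_⟩
  have hcont : Continuous fun x => X.toC2.OmTrChi x - 2 / v :=
    ((smooth_of_inH_scalar hX.c2.OmTrChi_mem).sub (SmoothS.const _)).continuous
  have h := hsob 8 (fun x => X.toC2.OmTrChi x - 2 / v) (1 / (|v| * C)) (by norm_num) hcont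
    (by positivity) ((sobolevNorm_OmTrChi_le (X - minkowski v)).trans_lt hnorm) x
  have h1 : |v * X.toC2.OmTrChi x - 2| ≤ 1 := by
    have e : v * X.toC2.OmTrChi x - 2 = v * (X.toC2.OmTrChi x - 2 / v) := by field_simp
    rw [e, abs_mul]
    calc |v| * |X.toC2.OmTrChi x - 2 / v| ≤ |v| * (C * (1 / (|v| * C))) := by gcongr
      _ = 1 := by field_simp
  linarith [(abs_le.1 h1).1]

/-- Once the other components agree, the three matching quantities determine the modes `l ≤ 1` of
`ω-bar`, `D-bar ω-bar` and `D-bar² ω-bar`. -/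
lemma low_modes_eq_of_matching {u v : ℝ} {X X' : C3Data} (hOm : X.toC2.Om = X'.toC2.Om)
    (hg : X.toC2.g = X'.toC2.g) (hT : X.toC2.OmTrChi = X'.toC2.OmTrChi)
    (hTb : X.toC2.OmTrChib = X'.toC2.OmTrChib) (heta : X.toC2.eta = X'.toC2.eta)
    (h0 : Qomb u v X.toC2 = Qomb u v X'.toC2) (h1 : QDbomb u v X.toC2 = QDbomb u v X'.toC2)
    (h2 : QDb2omb v X = QDb2omb v X') :
    modesLT 2 X.toC2.omb = modesLT 2 X'.toC2.omb ∧
      modesLT 2 X.toC2.Dbomb = modesLT 2 X'.toC2.Dbomb ∧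
      modesLT 2 X.Db2omb = modesLT 2 X'.Db2omb := by
  have hA : lapseCombination v X.toC2 = lapseCombination v X'.toC2 := by
    unfold lapseCombination; rw [hT, hOm]
  have hdiv : divEta1 X.toC2 = divEta1 X'.toC2 := by unfold divEta1; rw [heta]
  refine ⟨funext fun x => ?_, funext fun x => ?_, funext fun x => ?_⟩
  · have := congrFun h0 x
    simp only [Qomb, hA, hdiv, hg, hTb] at this
    linarith
  · have := congrFun h1 x
    simp only [QDbomb, hA, hdiv, hg, hTb] at this
    linarith
  · have := congrFun h2 x
    simp only [QDb2omb, hA, hdiv, hg, hTb] at this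
    linarith

end NullGluing

end

theorem mainTheorem7 (u v : ℝ) (huv : u < v) (hv : v ≠ 0) :
    ∃ ε : ℝ, 0 < ε ∧ ∀ X X' : NullGluing.C3Data,
      NullGluing.IsC3SphereData X → NullGluing.IsC3SphereData X' →
      NullGluing.c3Norm (X - NullGluing.minkowski v)
        + NullGluing.c3Norm (X' - NullGluing.minkowski v) < ENNReal.ofReal ε →
      NullGluing.matchingMap u v X = NullGluing.matchingMap u v X' →
      NullGluing.charges X = NullGluing.charges X' →
      X = X' := by
  open NullGluing in
  obtain ⟨ε, hε, hsign⟩ := exists_OmTrChi_sign hv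
  refine ⟨ε, hε, fun X X' hX hX' hnorm hM hQ => ?_⟩
  have hpos := hsign X hX (lt_of_le_of_lt le_self_add hnorm)
  have hM2 : c2Match u v X.toC2 = c2Match u v X'.toC2 := congrArg C3Matching.toC2 hM
  have hOm : X.toC2.Om = X'.toC2.Om := congrArg C2Matching.Om hM2
  have hT : X.toC2.OmTrChi = X'.toC2.OmTrChi := congrArg C2Matching.OmTrChi hM2
  have hchih : X.toC2.chih = X'.toC2.chih := congrArg C2Matching.chih hM2
  have hchibh : X.toC2.chibh = X'.toC2.chibh := congrArg C2Matching.chibh hM2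
  have halb : X.toC2.alb = X'.toC2.alb := congrArg C2Matching.alb hM2
  have hg : X.toC2.g = X'.toC2.g :=
    metric_eq_of_confFactor_eq (confFactor_pos hX.c2.g_metric hX.c2.g_mem.1)
      (congrArg C2Matching.phi hM2) (congrArg C2Matching.gc hM2)
  -- The orders of the harmonics are shifted indices in `Fin 3` and `Fin 5`.
  have hidx3 : ∀ k ∈ Finset.Icc (-1 : ℤ) 1, ∃ m : Fin 3, k = (m : ℤ) - 1 := by
    intro k hk
    obtain ⟨h1, h2⟩ := Finset.mem_Icc.1 hk
    exact ⟨⟨(k + 1).toNat, by omega⟩, by simp; omega⟩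
  have hidx5 : ∀ k ∈ Finset.Icc (-2 : ℤ) 2, ∃ m : Fin 5, k = (m : ℤ) - 2 := by
    intro k hk
    obtain ⟨h1, h2⟩ := Finset.mem_Icc.1 hk
    exact ⟨⟨(k + 2).toNat, by omega⟩, by simp; omega⟩
  have hE : coeff (energyDensity X.toC2) 0 0 = coeff (energyDensity X'.toC2) 0 0 :=
    mul_left_cancel₀ (by simp [Real.pi_ne_zero, Real.pi_pos.le]) (congrArg Charges.E hQ)
  have hP : ∀ k ∈ Finset.Icc (-1 : ℤ) 1,
      coeff (energyDensity X.toC2) 1 k = coeff (energyDensity X'.toC2) 1 k := by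
    intro k hk
    obtain ⟨m, rfl⟩ := hidx3 k hk
    refine mul_left_cancel₀ (a := -(1 / (8 * Real.pi)) * √(4 * Real.pi / 3)) ?_
      (congrFun (congrArg Charges.P hQ) m)
    exact mul_ne_zero (neg_ne_zero.2 (by positivity)) (by positivity)
  have hL : ∀ k ∈ Finset.Icc (-1 : ℤ) 1,
      coeffH (momentumDensity X.toC2) 1 k = coeffH (momentumDensity X'.toC2) 1 k := by
    intro k hk
    obtain ⟨m, rfl⟩ := hidx3 k hk
    exact mul_left_cancel₀ (a := 1 / (16 * Real.pi) * √(8 * Real.pi / 3)) (by positivity)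
      (congrFun (congrArg Charges.L hQ) m)
  have hG : ∀ k ∈ Finset.Icc (-1 : ℤ) 1,
      coeffE (momentumDensity X.toC2) 1 k = coeffE (momentumDensity X'.toC2) 1 k := by
    intro k hk
    obtain ⟨m, rfl⟩ := hidx3 k hk
    exact mul_left_cancel₀ (a := 1 / (16 * Real.pi) * √(8 * Real.pi / 3)) (by positivity)
      (congrFun (congrArg Charges.G hQ) m)
  have hU : ∀ k ∈ Finset.Icc (-2 : ℤ) 2,
      coeffPsi (thirdOrderDensity X) 2 k = coeffPsi (thirdOrderDensity X') 2 k := by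
    intro k hk
    obtain ⟨m, rfl⟩ := hidx5 k hk
    exact congrFun (congrArg Charges.U hQ) m
  have hV : ∀ k ∈ Finset.Icc (-2 : ℤ) 2,
      coeffPhi (thirdOrderDensity X) 2 k = coeffPhi (thirdOrderDensity X') 2 k := by
    intro k hk
    obtain ⟨m, rfl⟩ := hidx5 k hk
    exact congrFun (congrArg Charges.V hQ) m
  have heta : X.toC2.eta = X'.toC2.eta := eta_eq_of_momentum hX.c2 hX'.c2 hOm hg hT
    (congrArg C2Matching.etaGE2 hM2) hpos hG hL
  have hTb : X.toC2.OmTrChib = X'.toC2.OmTrChib := OmTrChib_eq_of_energy hX.c2 hX'.c2 hOm hg hT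
    hchih hchibh heta (congrArg C2Matching.OmTrChibGE2 hM2) hpos hE hP
  have hDbalb : X.Dbalb = X'.Dbalb :=
    Dbalb_eq_of_thirdOrder hX hX' hg halb (congrArg C3Matching.DbalbGE3 hM) hU hV
  obtain ⟨h0, h1, h2⟩ := low_modes_eq_of_matching hOm hg hT hTb heta
    (congrArg C2Matching.Qomb hM2) (congrArg C2Matching.QDbomb hM2)
    (congrArg C3Matching.QDb2omb hM)
  refine C3Data.ext (C2Data.ext hOm hg hT hchih hTb hchibh heta (congrArg C2Matching.om hM2)
    (congrArg C2Matching.Dom hM2) (eq_of_modes_eq (congrArg C2Matching.ombGE2 hM2) h0)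
    (eq_of_modes_eq (congrArg C2Matching.DbombGE2 hM2) h1) (congrArg C2Matching.al hM2) halb)
    (congrArg C3Matching.D2om hM) (eq_of_modes_eq (congrArg C3Matching.Db2ombGE2 hM) h2)
    (congrArg C3Matching.Dal hM) hDbalb
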